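/- Let $\mathcal{H}$ be a finite-dimensional complex Hilbert space, let $\mathcal{S}_1(\mathcal{H})$ be its unit sphere, and let $n \ge 0$, $k \ge 1$ and $0 \le r \le n$ be integers. For a permutation $\pi$ of $\{1,\dots,n\}$, write $\pi$ also for the unitary on $\mathcal{H}^{\otimes n}$ with $\pi(|\theta_1\rangle\otimes\cdots\otimes|\theta_n\rangle) = |\theta_{\pi^{-1}(1)}\rangle\otimes\cdots\otimes|\theta_{\pi^{-1}(n)}\rangle$. Let $\mathrm{Sym}(\mathcal{H}^{\otimes n})$ be the subspace of all $|\Psi\rangle\in\mathcal{H}^{\otimes n}$ with $\pi|\Psi\rangle=|\Psi\rangle$ for all $\pi$. For $|\theta\rangle\in\mathcal{H}$ and $0\le m\le n$, let $$\mathrm{Sym}(\mathcal{H}^{\otimes n},|\theta\rangle^{\otimes m}) := \mathrm{Sym}(\mathcal{H}^{\otimes n}) \cap \mathrm{span}\bigl\{\pi(|\theta\rangle^{\otimes m}\otimes|\tilde\Psi\rangle) : \pi\in\mathcal{S}_n,\ |\tilde\Psi\rangle\in\mathcal{H}^{\otimes n-m}\bigr\}$$ be the symmetric subspace along $|\theta\rangle^{\otimes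 m}$. A pure density operator on a subspace is a nonnegative operator of trace one and rank one whose support lies in that subspace. Let $\rho_{n+k}$ be a pure density operator on $\mathrm{Sym}(\mathcal{H}^{\otimes n+k})$, and let $\mathrm{tr}_k$ denote the partial trace over the last $k$ subsystems. Then there exist a Borel measure $\nu$ on $\mathcal{S}_1(\mathcal{H})$ with $\nu(\mathcal{S}_1(\mathcal{H}))\le 1$, which is a probability measure if $k\ge 2$, and, for each $|\theta\rangle\in\mathcal{S}_1(\mathcal{H})$, a pure density operator $\bar\rho_n^{|\theta\rangle}$ on $\mathrm{Sym}(\mathcal{H}^{\otimes n},|\theta\rangle^{\otimes n-r})$, such that $|\theta\rangle\mapsto\bar\rho_n^{|\theta\rangle}$ is $\nu$-integrable and $$\Bigl\|\mathrm{tr}_k(\rho_{n+k}) - \int_{\mathcal{S}_1(\mathcal{H})}\bar\rho_n^{|\theta\rangle}\,d\nu(|\theta\rangle)\Bigr\|_1 \le 2\,e^{-\frac{k(r+1)}{2(n+k)}+\frac12\dim(\mathcal{H})\ln k},$$ where $\|S\|_1=\mathrm{tr}|S|$ is the trace norm (without a factor $\frac12$). -/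

import Mathlib

open scoped TensorProduct

/-- The `n`-fold tensor power `H^{⊗n}` of a finite-dimensional complex Hilbert space `H`.  It is
Mathlib's `⨂[ℂ]^n H` under a name of its own, because the latter already carries the projective
seminorm, whereas `H^{⊗n}` is given its Hilbert space structure below. -/
def TensorPow (H : Type*) [NormedAddCommGroup H] [InnerProductSpace ℂ H] (n : ℕ) : Type _ :=
  ⨂[ℂ]^n H

namespace TensorPow

variable {H : Type*} [NormedAddCommGroup H] [InnerProductSpace ℂ H] [FiniteDimensional ℂ H]

/-- Coordinates of a tensor in the product basis of an orthonormal basis of `H`. -/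
noncomputable def coord (H : Type*) [NormedAddCommGroup H] [InnerProductSpace ℂ H]
    [FiniteDimensional ℂ H] (n : ℕ) :
    (⨂[ℂ]^n H) ≃ₗ[ℂ] EuclideanSpace ℂ (Fin n → Fin (Module.finrank ℂ H)) :=
  (Basis.piTensorProduct
      (fun _ : Fin n => (stdOrthonormalBasis ℂ H).toBasis)).equivFun.trans
    (WithLp.linearEquiv 2 ℂ ((Fin n → Fin (Module.finrank ℂ H)) → ℂ)).symm

/-- The Hilbert space norm of `H^{⊗n}`; it does not depend on the basis, see `inner_prodVec`. -/
noncomputable instance instNormedAddCommGroup (n : ℕ) : NormedAddCommGroup (TensorPow H n) :=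
  NormedAddCommGroup.induced (⨂[ℂ]^n H) _ (coord H n) (coord H n).injective

/-- The inner product of `H^{⊗n}`; it is characterised by `inner_prodVec`. -/
noncomputable instance instInnerProductSpace (n : ℕ) : InnerProductSpace ℂ (TensorPow H n) :=
  InnerProductSpace.induced (G := ⨂[ℂ]^n H) (coord H n)

/-- The identification of `H^{⊗n}` with Mathlib's tensor power. -/
noncomputable def equivTensorPower (n : ℕ) : TensorPow H n ≃ₗ[ℂ] (⨂[ℂ]^n H) :=
  LinearEquiv.refl ℂ (⨂[ℂ]^n H)

instance instFiniteDimensional (n : ℕ) : FiniteDimensional ℂ (TensorPow H n) :=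
  (equivTensorPower (H := H) n).symm.finiteDimensional

instance instCompleteSpace (n : ℕ) : CompleteSpace (TensorPow H n) :=
  FiniteDimensional.complete ℂ _

/-- The product vector `|x₁⟩ ⊗ ⋯ ⊗ |xₙ⟩`. -/
noncomputable def prodVec {n : ℕ} (x : Fin n → H) : TensorPow H n :=
  (equivTensorPower n).symm (PiTensorProduct.tprod ℂ x)

/-- The canonical isomorphism `H^{⊗a} ⊗ H^{⊗b} ≃ H^{⊗(a+b)}`. -/
noncomputable def mulEquiv (a b : ℕ) :
    TensorPow H a ⊗[ℂ] TensorPow H b ≃ₗ[ℂ] TensorPow H (a + b) :=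
  (TensorProduct.congr (equivTensorPower (H := H) a) (equivTensorPower (H := H) b)).trans
    (TensorPower.mulEquiv.trans (equivTensorPower (a + b)).symm)

/-- The (identity) isomorphism `H^{⊗a} ≃ H^{⊗b}` for `a = b`. -/
noncomputable def castEquiv {a b : ℕ} (h : a = b) : TensorPow H a ≃ₗ[ℂ] TensorPow H b :=
  (equivTensorPower a).trans ((TensorPower.cast ℂ H h).trans (equivTensorPower b).symm)

/-- The action of a permutation `π` of the subsystems,
`π (|x₁⟩ ⊗ ⋯ ⊗ |xₙ⟩) = |x_{π⁻¹(1)}⟩ ⊗ ⋯ ⊗ |x_{π⁻¹(n)}⟩`. -/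
noncomputable def permute {n : ℕ} (π : Equiv.Perm (Fin n)) :
    TensorPow H n ≃ₗ[ℂ] TensorPow H n :=
  (equivTensorPower n).trans
    ((PiTensorProduct.reindex ℂ (fun _ : Fin n => H) π).trans (equivTensorPower n).symm)

/-- The inner product of `H^{⊗n}` is the one with
`⟨x₁ ⊗ ⋯ ⊗ xₙ | y₁ ⊗ ⋯ ⊗ yₙ⟩ = ∏ᵢ ⟨xᵢ | yᵢ⟩`. -/
theorem inner_prodVec {n : ℕ} (x y : Fin n → H) :
    inner ℂ (prodVec x) (prodVec y) = ∏ i, inner ℂ (x i) (y i) := by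
  have key : ∀ (z : Fin n → H) (p : Fin n → Fin (Module.finrank ℂ H)),
      coord H n (PiTensorProduct.tprod ℂ z) p
        = ∏ i, inner ℂ (stdOrthonormalBasis ℂ H (p i)) (z i) := by
    intro z p
    simp [coord, OrthonormalBasis.repr_apply_apply]
  change inner ℂ (coord H n (PiTensorProduct.tprod ℂ x)) (coord H n (PiTensorProduct.tprod ℂ y)) = _
  rw [PiLp.inner_apply]
  simp only [key, RCLike.inner_apply, map_prod, inner_conj_symm]
  simp only [← Finset.prod_mul_distrib]
  rw [← Fintype.prod_sum (fun i j => inner ℂ (stdOrthonormalBasis ℂ H j) (y i) *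
    inner ℂ (x i) (stdOrthonormalBasis ℂ H j))]
  refine Finset.prod_congr rfl fun i _ => ?_
  rw [← (stdOrthonormalBasis ℂ H).sum_inner_mul_inner (x i) (y i)]
  exact Finset.sum_congr rfl fun j _ => mul_comm _ _

theorem permute_prodVec {n : ℕ} (π : Equiv.Perm (Fin n)) (x : Fin n → H) :
    permute π (prodVec x) = prodVec (fun i => x (π⁻¹ i)) := by
  simp only [permute, prodVec, LinearEquiv.trans_apply, LinearEquiv.apply_symm_apply]
  exact congrArg _ (PiTensorProduct.reindex_tprod π x)

theorem mulEquiv_prodVec {a b : ℕ} (x : Fin a → H) (y : Fin b → H) :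
    mulEquiv a b (prodVec x ⊗ₜ[ℂ] prodVec y) = prodVec (Fin.append x y) := by
  simp only [mulEquiv, prodVec, LinearEquiv.trans_apply, TensorProduct.congr_tmul,
    LinearEquiv.apply_symm_apply]
  exact congrArg _ (TensorPower.tprod_mul_tprod ℂ x y)

/-- The symmetric subspace `Sym(H^{⊗n})`: the vectors invariant under all permutations of the
subsystems. -/
noncomputable def symSubspace (H : Type*) [NormedAddCommGroup H] [InnerProductSpace ℂ H]
    [FiniteDimensional ℂ H] (n : ℕ) : Submodule ℂ (TensorPow H n) where
  carrier := {Ψ | ∀ π : Equiv.Perm (Fin n), permute π Ψ = Ψ}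
  add_mem' hx hy π := by rw [map_add, hx π, hy π]
  zero_mem' π := map_zero _
  smul_mem' c x hx π := by rw [map_smul, hx π]

/-- The set `V(H^{⊗n}, |θ⟩^{⊗m})` of all vectors `π (|θ⟩^{⊗m} ⊗ |Ψ⟩)` with `π` a permutation of the
`n` subsystems and `|Ψ⟩ ∈ H^{⊗(n-m)}`, where `m ≤ n`. -/
def alongSet {m n : ℕ} (h : m ≤ n) (θ : H) : Set (TensorPow H n) :=
  {Φ | ∃ (π : Equiv.Perm (Fin n)) (Ψ : TensorPow H (n - m)),
    Φ = permute π (castEquiv (Nat.add_sub_of_le h)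
      (mulEquiv m (n - m) (prodVec (fun _ : Fin m => θ) ⊗ₜ[ℂ] Ψ)))}

/-- The symmetric subspace `Sym(H^{⊗n}, |θ⟩^{⊗m})` of `H^{⊗n}` along `|θ⟩^{⊗m}`. -/
noncomputable def symSubspaceAlong {m n : ℕ} (h : m ≤ n) (θ : H) : Submodule ℂ (TensorPow H n) :=
  symSubspace H n ⊓ Submodule.span ℂ (alongSet h θ)

/-- The partial trace `tr_k` over the last `k` subsystems: the linear map from the operators on
`H^{⊗(n+k)}` to the operators on `H^{⊗n}` with `tr_k (A ⊗ B) = tr(B) A`. -/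
noncomputable def partialTrace (n k : ℕ)
    (T : TensorPow H (n + k) →L[ℂ] TensorPow H (n + k)) : TensorPow H n →L[ℂ] TensorPow H n :=
  LinearMap.toContinuousLinearMap
    (TensorProduct.rid ℂ (TensorPow H n →ₗ[ℂ] TensorPow H n)
      (LinearMap.lTensor _ (LinearMap.trace ℂ (TensorPow H k))
        ((homTensorHomEquiv ℂ (TensorPow H n) (TensorPow H k) (TensorPow H n)
          (TensorPow H k)).symm ((mulEquiv n k).symm.conj T.toLinearMap))))

theorem partialTrace_tensor (n k : ℕ) (A : TensorPow H n →ₗ[ℂ] TensorPow H n)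
    (B : TensorPow H k →ₗ[ℂ] TensorPow H k) :
    partialTrace n k
        (LinearMap.toContinuousLinearMap ((mulEquiv n k).conj (TensorProduct.map A B))) =
      LinearMap.trace ℂ _ B • LinearMap.toContinuousLinearMap A := by
  have h1 : (homTensorHomEquiv ℂ (TensorPow H n) (TensorPow H k) (TensorPow H n)
      (TensorPow H k)).symm (TensorProduct.map A B) = A ⊗ₜ[ℂ] B := by
    rw [LinearEquiv.symm_apply_eq]
    simp [TensorProduct.homTensorHomMap_apply]
  have h2 : (mulEquiv n k).symm.conj ((mulEquiv (H := H) n k).conj (TensorProduct.map A B)) =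
      TensorProduct.map A B := by
    ext x
    simp [LinearEquiv.conj_apply]
  unfold partialTrace
  rw [LinearMap.coe_toContinuousLinearMap, h2, h1]
  simp

end TensorPow

section operators

variable {V : Type*} [NormedAddCommGroup V] [InnerProductSpace ℂ V] [CompleteSpace V]

/-- The trace norm `‖S‖₁ = tr |S|`, where `|S| = √(S† S)`, on a finite-dimensional space. -/
noncomputable def traceNorm (S : V →L[ℂ] V) : ℝ :=
  (LinearMap.trace ℂ V (CFC.abs S).toLinearMap).re

/-- `ρ` is a density operator: a nonnegative operator of trace one. -/
def IsDensityOperator (ρ : V →L[ℂ] V) : Prop :=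
  ρ.IsPositive ∧ LinearMap.trace ℂ V ρ.toLinearMap = 1

/-- `ρ` is a pure density operator on the subspace `W`: a density operator of rank one whose
support lies in `W`. -/
def IsPureDensityOperatorOn (W : Submodule ℂ V) (ρ : V →L[ℂ] V) : Prop :=
  IsDensityOperator ρ ∧ Module.finrank ℂ (LinearMap.range ρ.toLinearMap) = 1 ∧
    LinearMap.range ρ.toLinearMap ≤ W

end operators

/-!
Let `ρ = |Ψ⟩⟨Ψ|` with `Ψ` a symmetric unit vector.  The identity of `Sym(H^{⊗k})` is a combination,
with nonnegative weights `w j`, of finitely many operators `|θ j⟩⟨θ j|^{⊗k}` with `θ j` a unit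
vector (`exists_symmetric_quadrature`, `TensorPow.nonempty_symResolution`).  Inserting it in the
last `k` subsystems gives `tr_k ρ = ∑ j, w j |x j⟩⟨x j|` with `x j = (1 ⊗ ⟨θ j|^{⊗k}) Ψ`, where the
weighted squared norms `w j ‖x j‖²` add up to one
(`TensorPow.SymResolution.partialTrace_rankOne_self`).

Take a product basis given by an orthonormal basis of `H` that contains `θ j`.  The part of `x j`
with at most `r` labels different from `θ j` lies in the symmetric subspace along `θ j`.  The rest
is exponentially small: the squared coefficients of `Ψ` are invariant under permutations of the
`n + k` positions, so every further position that is required to carry the label `θ j` reduces the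
weight of the labellings with at least `r + 1` other labels at least by a factor
`1 - (r + 1) / (n + k)` (`card_mul_tailWeight_insert_le`).  Hence `x j` and its truncation are at
distance at most `exp (-k (r + 1) / (2 (n + k)))` (`TensorPow.exists_truncation`).

The measure has mass `w j ‖x j‖²` at `θ j`, and the pure state at `θ j` is that of the truncation of
`x j`, rescaled to a unit vector; this costs at most `2 ‖x j‖` times the distance in trace norm
(`exists_unit_approximation`).  By the Cauchy-Schwarz inequality the total error is at most twice
the distance times the square root of `∑ j, w j`, which is at most `dim Sym(H^{⊗k}) ≤ k ^ dim H`
when `k ≥ 2` (`Nat.multichoose_le_pow`).  For `k = 1` the bound claimed is at least one, which is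
the trace norm of `tr_k ρ`, so the zero measure satisfies it.
-/

/-! ### Permutations that carry one labelling to another -/

section Labellings

variable {κ ι : Type*} [Fintype κ] [DecidableEq κ] [DecidableEq ι]

/-- The number of permutations `π` with `a ∘ π = b`.  Up to the factor `1 / |κ|!`, these numbers are
the entries of the projection onto the symmetric tensors in a product basis. -/
def numPerm (a b : κ → ι) : ℕ :=
  (Finset.univ.filter fun π : Equiv.Perm κ => a ∘ π = b).card

theorem numPerm_ne_zero_iff {a b : κ → ι} :
    numPerm a b ≠ 0 ↔
      ∀ j, Fintype.card {i // a i = j} = Fintype.card {i // b i = j} := by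
  rw [numPerm, Finset.card_ne_zero, Finset.filter_nonempty_iff]
  constructor
  · rintro ⟨π, -, rfl⟩ j
    exact (Fintype.card_congr (π.subtypeEquiv fun i => Iff.rfl)).symm
  · intro h
    let e := Equiv.ofFiberEquiv (f := b) (g := a) fun j => Fintype.equivOfCardEq (h j).symm
    exact ⟨e, Finset.mem_univ _, funext fun i => Equiv.ofFiberEquiv_map _ i⟩

theorem numPerm_self [Fintype ι] (a : κ → ι) :
    numPerm a a = ∏ j, (Fintype.card {i // a i = j}).factorial := by
  rw [← DomMulAct.stabilizer_card a, numPerm, Fintype.card_subtype]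

theorem numPerm_comp_right (a b : κ → ι) (σ : Equiv.Perm κ) :
    numPerm a (b ∘ σ) = numPerm a b := by
  refine Finset.card_bij' (fun π _ => π * σ⁻¹) (fun π _ => π * σ) ?_ ?_ ?_ ?_
  · intro π h
    simp only [Finset.mem_filter, Finset.mem_univ, true_and] at h ⊢
    ext i
    simpa using congrFun h (σ⁻¹ i)
  · intro π h
    simp only [Finset.mem_filter, Finset.mem_univ, true_and] at h ⊢
    ext i
    simpa using congrFun h (σ i)
  · intro π _; simp
  · intro π _; simp

theorem numPerm_comp_left (a b : κ → ι) (σ : Equiv.Perm κ) :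
    numPerm (a ∘ σ) b = numPerm a b := by
  refine Finset.card_bij' (fun π _ => σ * π) (fun π _ => σ⁻¹ * π) ?_ ?_ ?_ ?_
  · intro π h
    simp only [Finset.mem_filter, Finset.mem_univ, true_and] at h ⊢
    exact h
  · intro π h
    simp only [Finset.mem_filter, Finset.mem_univ, true_and] at h ⊢
    ext i
    simpa using congrFun h i
  · intro π _; simp
  · intro π _; simp

theorem exists_perm_of_numPerm_ne_zero {a b : κ → ι} (h : numPerm a b ≠ 0) :
    ∃ σ : Equiv.Perm κ, a ∘ σ = b := by
  rw [numPerm, Finset.card_ne_zero, Finset.filter_nonempty_iff] at h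
  obtain ⟨σ, -, hσ⟩ := h
  exact ⟨σ, hσ⟩

theorem numPerm_eq_ite (a b : κ → ι) :
    numPerm a b = if numPerm a b ≠ 0 then numPerm a a else 0 := by
  split_ifs with h
  · obtain ⟨σ, rfl⟩ := exists_perm_of_numPerm_ne_zero h
    exact numPerm_comp_right a a σ
  · simpa using h

theorem sum_numPerm [Fintype ι] (a : κ → ι) : ∑ b, numPerm a b = (Fintype.card κ).factorial := by
  rw [← Fintype.card_perm, ← Finset.card_univ (α := Equiv.Perm κ)]
  exact (Finset.card_eq_sum_card_fiberwise fun _ _ => Finset.mem_coe.2 (Finset.mem_univ _)).symm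

/-- The diagonal sum is `|κ|!` times the number of multisets of size `|κ|`: each class of labellings
with a common multiset of values contributes `|κ|!`. -/
theorem sum_numPerm_self_le [Fintype ι] :
    ∑ a : κ → ι, numPerm a a
      ≤ Nat.multichoose (Fintype.card ι) (Fintype.card κ) * (Fintype.card κ).factorial := by
  classical
  let f : (κ → ι) → Sym ι (Fintype.card κ) := fun a =>
    Sym.mk (Finset.univ.val.map a) (by rw [Multiset.card_map, Finset.card_val, Finset.card_univ])
  have hf : ∀ a b, f a = f b ↔ numPerm a b ≠ 0 := by
    intro a b
    rw [numPerm_ne_zero_iff]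
    refine Subtype.ext_iff.trans ?_
    change Multiset.map a _ = Multiset.map b _ ↔ _
    rw [Multiset.ext]
    refine forall_congr' fun j => ?_
    rw [Multiset.count_map, Multiset.count_map, Fintype.card_subtype, Fintype.card_subtype]
    simp only [Finset.card, Finset.filter_val, eq_comm]
  rw [← Finset.sum_fiberwise_of_maps_to (s := Finset.univ) (t := Finset.univ) (g := f)
    (fun _ _ => Finset.mem_univ _), ← Sym.card_sym_eq_multichoose,
    ← Finset.card_univ (α := Sym ι (Fintype.card κ)), ← smul_eq_mul]
  refine Finset.sum_le_card_nsmul _ _ _ fun s _ => ?_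
  by_cases hs : ∃ a₀, f a₀ = s
  · obtain ⟨a₀, rfl⟩ := hs
    rw [← sum_numPerm a₀]
    refine (Finset.sum_congr rfl fun a ha => ?_).trans_le
      (Finset.sum_le_sum_of_subset (f := numPerm a₀) (Finset.subset_univ _))
    obtain ⟨σ, rfl⟩ := exists_perm_of_numPerm_ne_zero
      ((hf _ _).1 (Finset.mem_filter.1 ha).2.symm)
    rw [numPerm_comp_right, numPerm_comp_left, numPerm_comp_right]
  · rw [Finset.filter_false_of_mem fun a _ h => hs ⟨a, h⟩]
    simp

/-- For `k = 1` and `d ≥ 2` this fails. -/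
theorem Nat.multichoose_le_pow {d k : ℕ} (hd : 1 ≤ d) (hk : 2 ≤ k) :
    Nat.multichoose d k ≤ k ^ d := by
  rcases hd.eq_or_lt with rfl | hd
  · simp; omega
  induction d, Nat.succ_le_of_lt hd using Nat.le_induction with
  | base => rw [Nat.multichoose_two]; nlinarith
  | succ d hd2 ih =>
    specialize ih (by omega) (by omega)
    rw [Nat.multichoose_eq] at ih ⊢
    have h1 : (d + 1 + k - 1).choose k * d = (d + k - 1).choose k * (d + k) := by
      have := Nat.choose_mul_succ_eq (d + k - 1) k
      rw [show d + k - 1 + 1 = d + k by omega, show d + k - k = d by omega] at this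
      rw [show d + 1 + k - 1 = d + k by omega]
      exact this.symm
    have h2 : d + k ≤ d * k := by nlinarith
    refine Nat.le_of_mul_le_mul_right (c := d) ?_ (by omega)
    rw [h1, pow_succ, mul_assoc, mul_comm k d]
    exact Nat.mul_le_mul ih h2

end Labellings

/-! ### A finite quadrature for the symmetric tensors -/

section Quadrature

open MeasureTheory

theorem Fin.sum_dite_lt {M : Type*} [AddCommMonoid M] {m D : ℕ} (h : m ≤ D) (g : Fin m → M) :
    ∑ i : Fin D, (if hi : (i : ℕ) < m then g ⟨i, hi⟩ else 0) = ∑ i, g i := by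
  rw [← Finset.sum_subset (Finset.subset_univ (Finset.univ.map (Fin.castLEEmb h)))]
  · rw [Finset.sum_map]
    exact Finset.sum_congr rfl fun i _ => by simp
  · intro i _ hi
    have : ¬ (i : ℕ) < m := fun hm => hi (by
      simp only [Finset.mem_map, Finset.mem_univ, true_and]
      exact ⟨⟨i, hm⟩, by ext; simp⟩)
    simp [this]

/-- By Carathéodory's theorem the convex hull is a continuous image of a compact set. -/
theorem IsCompact.convexHull_of_finiteDimensional {E : Type*} [NormedAddCommGroup E]
    [NormedSpace ℝ E] [FiniteDimensional ℝ E] {s : Set E} (hs : IsCompact s) :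
    IsCompact (convexHull ℝ s) := by
  let D := Module.finrank ℝ E + 1
  let T : Set E := (fun p : (Fin D → ℝ) × (Fin D → E) => ∑ i, p.1 i • p.2 i) ''
    (stdSimplex ℝ (Fin D) ×ˢ Set.univ.pi fun _ => s)
  have hT : IsCompact T := by
    refine ((isCompact_stdSimplex ℝ (Fin D)).prod (isCompact_univ_pi fun _ => hs)).image ?_
    fun_prop
  convert hT
  apply Set.Subset.antisymm
  · intro x hx
    rw [convexHull_eq_union] at hx
    simp only [Set.mem_iUnion] at hx
    obtain ⟨t, hts, hti, hxt⟩ := hx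
    have hne : t.Nonempty := by
      rcases t.eq_empty_or_nonempty with rfl | h
      · simp at hxt
      · exact h
    obtain ⟨y₀, hy₀⟩ := hne
    have hcard : t.card ≤ D := by
      have := hti.card_le_finrank_succ
      rw [Fintype.card_coe] at this
      exact this.trans (Nat.succ_le_succ (Submodule.finrank_le _))
    obtain ⟨w, hw0, hw1, hwx⟩ := Finset.mem_convexHull'.1 hxt
    -- Enumerate `t` by the first `#t` indices and pad with a point of weight zero.
    let e : Fin t.card ≃ t := t.equivFin.symm
    let z : Fin D → E := fun i => if h : (i : ℕ) < t.card then (e ⟨i, h⟩ : E) else y₀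
    let v : Fin D → ℝ := fun i => if h : (i : ℕ) < t.card then w (e ⟨i, h⟩) else 0
    refine ⟨(v, z), ⟨⟨fun i => ?_, ?_⟩, fun i _ => ?_⟩, ?_⟩
    · simp only [v]; split_ifs with h
      · exact hw0 _ (e _).2
      · exact le_rfl
    · refine (Fin.sum_dite_lt hcard fun i => w (e i)).trans ?_
      rw [Equiv.sum_comp e fun y : t => w y, Finset.sum_coe_sort t w, hw1]
    · simp only [z]; split_ifs with h
      · exact hts (e _).2
      · exact hts hy₀
    · rw [← hwx, ← Finset.sum_coe_sort t fun y => w y • y, ← Equiv.sum_comp e,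
        ← Fin.sum_dite_lt hcard]
      refine Finset.sum_congr rfl fun i _ => ?_
      simp only [v, z]; split_ifs <;> simp
  · rintro _ ⟨⟨v, z⟩, ⟨⟨hv0, hv1⟩, hz⟩, rfl⟩
    exact (convex_convexHull ℝ s).sum_mem (fun i _ => hv0 i) hv1
      fun i _ => subset_convexHull ℝ s (hz i trivial)

theorem integrableOn_pow_mul_exp_neg (m : ℕ) :
    IntegrableOn (fun x : ℝ => x ^ m * Real.exp (-x)) (Set.Ioi 0) := by
  have := Real.GammaIntegral_convergent (s := m + 1) (by positivity)
  simpa [mul_comm] using this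

theorem integral_pow_mul_exp_neg (m : ℕ) :
    ∫ x : ℝ in Set.Ioi 0, x ^ m * Real.exp (-x) = m.factorial := by
  rw [← Real.Gamma_nat_eq_factorial, Real.Gamma_eq_integral (by positivity)]
  simp [mul_comm]

variable {κ ι : Type*} [Fintype κ]

/-- Integrating a polynomial that is nonnegative on the orthant against independent exponential
variables, whose `m`-th moment is `m!`. -/
theorem sum_mul_numPerm_self_nonneg [DecidableEq κ] [Fintype ι] [DecidableEq ι]
    (c : (κ → ι) → ℝ)
    (h : ∀ t : ι → ℝ, (∀ j, 0 ≤ t j) → 0 ≤ ∑ a, c a * ∏ i, t (a i)) :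
    0 ≤ ∑ a, c a * numPerm a a := by
  let μ : Measure (ι → ℝ) := Measure.pi fun _ => volume.restrict (Set.Ioi 0)
  let p (a : κ → ι) (t : ι → ℝ) : ℝ :=
    ∏ j, (t j ^ Fintype.card {i // a i = j} * Real.exp (-t j))
  have hp : ∀ a t, p a t = (∏ i, t (a i)) * ∏ j, Real.exp (-t j) := by
    intro a t
    simp only [p, Finset.prod_mul_distrib]
    congr 1
    rw [← Finset.prod_fiberwise Finset.univ a fun i => t (a i)]
    refine Finset.prod_congr rfl fun j _ => ?_
    rw [Finset.prod_congr rfl fun i hi => by rw [(Finset.mem_filter.1 hi).2],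
      Finset.prod_const, Fintype.card_subtype]
  have hint : ∀ a, Integrable (p a) μ := fun a =>
    Integrable.fintype_prod fun j => integrableOn_pow_mul_exp_neg _
  have hval : ∀ a, ∫ t, p a t ∂μ = numPerm a a := by
    intro a
    rw [numPerm_self]
    push_cast
    refine (integral_fintype_prod_eq_prod (𝕜 := ℝ) (fun (j : ι) (x : ℝ) =>
      x ^ Fintype.card {i // a i = j} * Real.exp (-x))).trans ?_
    exact Finset.prod_congr rfl fun j _ => integral_pow_mul_exp_neg _
  have h0 : 0 ≤ ∫ t, ∑ a, c a * p a t ∂μ := by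
    refine integral_nonneg_of_ae ?_
    have hpos : ∀ᵐ t ∂μ, ∀ j, 0 ≤ t j := by
      rw [ae_all_iff]
      intro j
      have : ∀ᵐ x ∂(volume.restrict (Set.Ioi (0 : ℝ))), 0 ≤ x :=
        (ae_restrict_mem measurableSet_Ioi).mono fun x hx => le_of_lt hx
      exact (Measure.quasiMeasurePreserving_eval _ j).ae this
    filter_upwards [hpos] with t ht
    simp only [hp, ← mul_assoc, ← Finset.sum_mul]
    exact mul_nonneg (h t ht) (Finset.prod_nonneg fun j _ => (Real.exp_pos _).le)
  rw [integral_finsetSum _ fun a _ => (hint a).const_mul _] at h0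
  simpa only [integral_const_mul, hval] using h0

/-- Averaging over the phases `ζ ^ m j`, with `ζ` a root of unity of order exceeding the degree,
kills all pairs of labellings with different multisets of values. -/
theorem sum_prod_rootOfUnity [DecidableEq κ] [Fintype ι] [DecidableEq ι] {K : ℕ} {ζ : ℂ}
    (hζ : IsPrimitiveRoot ζ K)
    (hK : Fintype.card κ < K) (a b : κ → ι) :
    ∑ m : ι → Fin K, ∏ i, ζ ^ (m (a i) : ℕ) * (starRingEnd ℂ) (ζ ^ (m (b i) : ℕ))
      = if numPerm a b ≠ 0 then (K : ℂ) ^ Fintype.card ι else 0 := by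
  let α (j : ι) := Fintype.card {i // a i = j}
  let β (j : ι) := Fintype.card {i // b i = j}
  have hKpos : K ≠ 0 := by omega
  have hconj : ζ * (starRingEnd ℂ) ζ = 1 := by
    rw [Complex.mul_conj, Complex.normSq_eq_norm_sq, hζ.norm'_eq_one hKpos]
    norm_num
  have hprod : ∀ (m : ι → Fin K) (a : κ → ι), ∏ i, ζ ^ (m (a i) : ℕ)
      = ∏ j, (ζ ^ Fintype.card {i // a i = j}) ^ (m j : ℕ) := by
    intro m a
    rw [← Finset.prod_fiberwise Finset.univ a fun i => ζ ^ (m (a i) : ℕ)]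
    refine Finset.prod_congr rfl fun j _ => ?_
    rw [Finset.prod_congr rfl fun i hi => by rw [(Finset.mem_filter.1 hi).2],
      Finset.prod_const, Fintype.card_subtype, ← pow_mul, ← pow_mul, mul_comm]
  have h1 : ∀ m : ι → Fin K,
      ∏ i, ζ ^ (m (a i) : ℕ) * (starRingEnd ℂ) (ζ ^ (m (b i) : ℕ))
        = ∏ j, (ζ ^ α j * (starRingEnd ℂ) (ζ ^ β j)) ^ (m j : ℕ) := by
    intro m
    rw [Finset.prod_mul_distrib, ← map_prod, hprod m a, hprod m b, map_prod,
      ← Finset.prod_mul_distrib]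
    exact Finset.prod_congr rfl fun j _ => by rw [mul_pow, map_pow]
  have h2 : ∀ j, ∑ x : Fin K, (ζ ^ α j * (starRingEnd ℂ) (ζ ^ β j)) ^ (x : ℕ)
      = if α j = β j then (K : ℂ) else 0 := by
    intro j
    set z := ζ ^ α j * (starRingEnd ℂ) (ζ ^ β j) with hz
    have hzK : z ^ K = 1 := by
      rw [hz, mul_pow, ← map_pow, ← pow_mul, ← pow_mul, mul_comm (α j), mul_comm (β j), pow_mul,
        pow_mul, hζ.pow_eq_one]
      simp
    rw [Fin.sum_univ_eq_sum_range (fun x => z ^ x) K]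
    split_ifs with h
    · have : z = 1 := by rw [hz, h, map_pow, ← mul_pow, hconj, one_pow]
      simp [this]
    · have hz1 : z - 1 ≠ 0 := by
        intro hz1
        refine h (hζ.pow_inj ((Fintype.card_subtype_le _).trans_lt hK)
          ((Fintype.card_subtype_le _).trans_lt hK) ?_)
        calc ζ ^ α j = z * ζ ^ β j := by
              rw [hz, mul_assoc, map_pow, ← mul_pow, mul_comm _ ζ, hconj, one_pow, mul_one]
          _ = ζ ^ β j := by rw [sub_eq_zero.1 hz1, one_mul]
      have := mul_geom_sum z K
      rw [hzK, sub_self] at this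
      exact (mul_eq_zero.1 this).resolve_left hz1
  simp_rw [h1]
  rw [← Fintype.prod_sum fun j (x : Fin K) => (ζ ^ α j * (starRingEnd ℂ) (ζ ^ β j)) ^ (x : ℕ)]
  simp_rw [h2]
  split_ifs with h
  · rw [numPerm_ne_zero_iff] at h
    rw [Finset.prod_congr rfl fun j _ => if_pos (h j), Finset.prod_const, Finset.card_univ]
  · rw [numPerm_ne_zero_iff] at h
    push Not at h
    obtain ⟨j, hj⟩ := h
    exact Finset.prod_eq_zero (Finset.mem_univ j) (if_neg hj)

/-- The matrix of `|v⟩⟨v|^{⊗κ}` in the product basis. -/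
def powMatrix (κ : Type*) [Fintype κ] (v : EuclideanSpace ℂ ι) :
    (κ → ι) → (κ → ι) → ℂ :=
  fun a b => ∏ i, v (a i) * (starRingEnd ℂ) (v (b i))

theorem sum_re_powMatrix [DecidableEq κ] [Fintype ι] (v : EuclideanSpace ℂ ι) :
    ∑ a, (powMatrix κ v a a).re = (‖v‖ ^ 2) ^ Fintype.card κ := by
  have : ∑ a, powMatrix κ v a a = (((‖v‖ ^ 2) ^ Fintype.card κ : ℝ) : ℂ) := by
    rw [EuclideanSpace.norm_sq_eq]
    push_cast
    rw [← Finset.card_univ, ← Finset.prod_const, Fintype.prod_sum]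
    refine Finset.sum_congr rfl fun a _ => Finset.prod_congr rfl fun i _ => ?_
    rw [Complex.mul_conj, Complex.normSq_eq_norm_sq]
    push_cast; rfl
  rw [← Complex.re_sum, this, Complex.ofReal_re]

theorem powMatrix_smul (c : ℝ) (v : EuclideanSpace ℂ ι) :
    powMatrix κ ((c : ℂ) • v) = ((c ^ 2) ^ Fintype.card κ) • powMatrix κ v := by
  funext a b
  simp only [powMatrix, PiLp.smul_apply, smul_eq_mul, map_mul, Complex.conj_ofReal, Pi.smul_apply,
    Complex.real_smul]
  rw [← Finset.card_univ]
  push_cast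
  rw [← Finset.prod_const, ← Finset.prod_mul_distrib]
  exact Finset.prod_congr rfl fun i _ => by ring

/-- The projection onto the symmetric tensors is a finite nonnegative combination of the operators
`|v⟩⟨v|^{⊗κ}` with `v` a unit vector.  If it were not, a real functional would separate it from the
compact convex hull of these operators, against its being their average over the Gaussian measure;
the latter is an average over the phases and over independent exponential variables `|v j| ^ 2`. -/
theorem exists_symmetric_quadrature (κ ι : Type) [Fintype κ] [DecidableEq κ] [Nonempty κ]
    [Fintype ι] [DecidableEq ι] [Nonempty ι] :
    ∃ (J : Type) (_ : Fintype J) (w : J → ℝ) (x : J → EuclideanSpace ℂ ι),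
      (∀ j, 0 ≤ w j) ∧ (∀ j, ‖x j‖ = 1) ∧
      ∀ a b : κ → ι, ∑ j, (w j : ℂ) * ∏ i, x j (a i) * (starRingEnd ℂ) (x j (b i))
        = (numPerm a b : ℂ) / (Fintype.card κ).factorial := by
  let M : (κ → ι) → (κ → ι) → ℂ := fun a b => (numPerm a b : ℂ)
  let τ : ℝ := ∑ a : κ → ι, (numPerm a a : ℝ)
  have hτ : 0 < τ := by
    refine Finset.sum_pos (fun a _ => ?_) Finset.univ_nonempty
    rw [numPerm_self]
    exact_mod_cast Finset.prod_pos fun j _ => Nat.factorial_pos _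
  let K : Set ((κ → ι) → (κ → ι) → ℂ) :=
    convexHull ℝ (powMatrix κ '' Metric.sphere (0 : EuclideanSpace ℂ ι) 1)
  have hK : IsCompact K := by
    refine IsCompact.convexHull_of_finiteDimensional ((isCompact_sphere _ _).image ?_)
    unfold powMatrix
    fun_prop
  have hmem : τ⁻¹ • M ∈ K := by
    by_contra hM
    obtain ⟨f, u, hfM, hfK⟩ :=
      geometric_hahn_banach_point_closed (convex_convexHull ℝ _) hK.isClosed hM
    let tr : ((κ → ι) → (κ → ι) → ℂ) →ₗ[ℝ] ℝ := ∑ a : κ → ι,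
      Complex.reLm ∘ₗ (LinearMap.proj a) ∘ₗ (LinearMap.proj a)
    have htr : ∀ A : (κ → ι) → (κ → ι) → ℂ, tr A = ∑ a, (A a a).re := fun A => by simp [tr]
    let g : ((κ → ι) → (κ → ι) → ℂ) →ₗ[ℝ] ℝ := f.toLinearMap - u • tr
    have hg : ∀ A : (κ → ι) → (κ → ι) → ℂ, g A = f A - u * ∑ a, (A a a).re :=
      fun A => by simp [g, htr]
    have hgF : ∀ v : EuclideanSpace ℂ ι, 0 ≤ g (powMatrix κ v) := by
      intro v
      by_cases hv : v = 0
      · have : powMatrix κ v = 0 := by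
          funext a b
          simp [powMatrix, hv]
        rw [this, map_zero]
      · have hn : ‖v‖ ≠ 0 := norm_ne_zero_iff.2 hv
        let v' : EuclideanSpace ℂ ι := ((‖v‖⁻¹ : ℝ) : ℂ) • v
        have hv' : ‖v'‖ = 1 := by
          rw [norm_smul, Complex.norm_real, norm_inv, norm_norm, inv_mul_cancel₀ hn]
        have hvv : v = ((‖v‖ : ℝ) : ℂ) • v' := by
          rw [smul_smul, ← Complex.ofReal_mul, mul_inv_cancel₀ hn, Complex.ofReal_one, one_smul]
        rw [hvv, powMatrix_smul, map_smul, smul_eq_mul]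
        refine mul_nonneg (by positivity) ?_
        rw [hg, sum_re_powMatrix, hv', one_pow, one_pow, mul_one]
        exact sub_nonneg.2 (hfK _ (subset_convexHull ℝ _
          ⟨v', by simpa using hv', rfl⟩)).le
    let B (a : κ → ι) : (κ → ι) → (κ → ι) → ℂ :=
      fun a' b' => if a' = a ∧ numPerm a' b' ≠ 0 then 1 else 0
    have hsumB : ∀ c : (κ → ι) → ℝ, ∑ a, c a • B a
        = fun a' b' => if numPerm a' b' ≠ 0 then (c a' : ℂ) else 0 := by
      intro c
      funext a' b'
      simp only [B, Finset.sum_apply, Pi.smul_apply, Complex.real_smul]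
      rw [Finset.sum_eq_single a']
      · simp
      · intro a _ ha
        simp [ha.symm]
      · simp
    let N := Fintype.card κ + 1
    obtain ⟨ζ, hζ⟩ : ∃ ζ : ℂ, IsPrimitiveRoot ζ N :=
      ⟨_, Complex.isPrimitiveRoot_exp N (Nat.succ_ne_zero _)⟩
    have hpos : 0 ≤ ∑ a, g (B a) * (numPerm a a : ℝ) := by
      refine sum_mul_numPerm_self_nonneg (fun a => g (B a)) fun t ht => ?_
      let v (m : ι → Fin N) : EuclideanSpace ℂ ι :=
        WithLp.toLp 2 fun j => ((√(t j) : ℝ) : ℂ) * ζ ^ (m j : ℕ)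
      have hv : ∑ m, powMatrix κ (v m)
          = ((N : ℝ) ^ Fintype.card ι) • ∑ a, (∏ i, t (a i)) • B a := by
        rw [hsumB]
        funext a b
        simp only [Finset.sum_apply, Pi.smul_apply, powMatrix, v, map_mul, Complex.conj_ofReal]
        have h3 : ∀ m : ι → Fin N, ∏ i, ((√(t (a i)) : ℝ) : ℂ) * ζ ^ (m (a i) : ℕ) *
            (((√(t (b i)) : ℝ) : ℂ) * (starRingEnd ℂ) (ζ ^ (m (b i) : ℕ)))
            = ((∏ i, ((√(t (a i)) : ℝ) : ℂ)) * ∏ i, ((√(t (b i)) : ℝ) : ℂ)) *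
              ∏ i, ζ ^ (m (a i) : ℕ) * (starRingEnd ℂ) (ζ ^ (m (b i) : ℕ)) := by
          intro m
          rw [← Finset.prod_mul_distrib, ← Finset.prod_mul_distrib]
          exact Finset.prod_congr rfl fun i _ => by ring
        simp_rw [h3]
        rw [← Finset.mul_sum, sum_prod_rootOfUnity hζ (Nat.lt_succ_self _)]
        split_ifs with h
        · obtain ⟨σ, rfl⟩ := exists_perm_of_numPerm_ne_zero h
          have h4 : ∏ i, ((√(t ((a ∘ σ) i)) : ℝ) : ℂ) = ∏ i, ((√(t (a i)) : ℝ) : ℂ) :=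
            Equiv.prod_comp σ fun i => ((√(t (a i)) : ℝ) : ℂ)
          rw [h4, ← Finset.prod_mul_distrib, Complex.real_smul, mul_comm]
          push_cast
          congr 1
          refine Finset.prod_congr rfl fun i _ => ?_
          rw [← Complex.ofReal_mul, Real.mul_self_sqrt (ht _)]
        · simp
      have h5 : 0 ≤ g (∑ m, powMatrix κ (v m)) := by
        rw [map_sum]
        exact Finset.sum_nonneg fun m _ => hgF _
      rw [hv, map_smul, map_sum, smul_eq_mul] at h5
      have h6 := nonneg_of_mul_nonneg_right h5 (by positivity)
      simpa only [map_smul, smul_eq_mul, mul_comm] using h6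
    have hgM : ∑ a, g (B a) * (numPerm a a : ℝ) = g M := by
      have : M = ∑ a, (numPerm a a : ℝ) • B a := by
        rw [hsumB]
        funext a b
        simp only [M]
        rw [numPerm_eq_ite]
        split_ifs <;> simp_all
      rw [this, map_sum]
      simp only [map_smul, smul_eq_mul, mul_comm]
    rw [hgM, hg] at hpos
    have h7 : ∑ a, (M a a).re = τ := by simp [M, τ]
    rw [h7] at hpos
    rw [map_smul, smul_eq_mul, inv_mul_lt_iff₀ hτ] at hfM
    linarith
  obtain ⟨J, hJ, w, z, hw0, -, hz, hwz⟩ := mem_convexHull_iff_exists_fintype.1 hmem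
  choose x hx hxz using hz
  let q : ℝ := τ / (Fintype.card κ).factorial
  have hq : 0 ≤ q := by positivity
  refine ⟨J, hJ, fun j => q * w j, x, fun j => mul_nonneg hq (hw0 j),
    fun j => by simpa using hx j, fun a b => ?_⟩
  have h8 := congrFun (congrFun hwz a) b
  simp only [Finset.sum_apply, Pi.smul_apply, ← hxz, powMatrix, Complex.real_smul, M] at h8
  calc ∑ j, ((q * w j : ℝ) : ℂ) * ∏ i, x j (a i) * (starRingEnd ℂ) (x j (b i))
      = (q : ℂ) * ∑ j, (w j : ℂ) * ∏ i, x j (a i) * (starRingEnd ℂ) (x j (b i)) := by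
        rw [Finset.mul_sum]
        exact Finset.sum_congr rfl fun j _ => by push_cast; ring
    _ = _ := by
        rw [h8]
        have : (τ : ℂ) ≠ 0 := by exact_mod_cast hτ.ne'
        simp only [q]
        push_cast
        field_simp

end Quadrature

/-! ### Product vectors, permutations and contractions -/

-- `Inner ℂ (TensorPow H n)` should be found through `InnerProductSpace`, to which the lemmas on
-- inner products apply, and not through the C⋆-module structure.
attribute [local instance 10000] InnerProductSpace.toInner

namespace TensorPow

section Contraction

variable {H : Type*} [NormedAddCommGroup H] [InnerProductSpace ℂ H] [FiniteDimensional ℂ H]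

theorem inner_prodVec_prodVec {n : ℕ} (x y : Fin n → H) :
    inner ℂ (prodVec x) (prodVec y) = ∏ i, inner ℂ (x i) (y i) :=
  inner_prodVec x y

theorem span_range_prodVec (n : ℕ) :
    Submodule.span ℂ (Set.range (prodVec : (Fin n → H) → TensorPow H n)) = ⊤ :=
  PiTensorProduct.span_tprod_eq_top

theorem induction_prodVec {n : ℕ} {p : TensorPow H n → Prop} (h0 : p 0)
    (hadd : ∀ x y, p x → p y → p (x + y)) (hsmul : ∀ (c : ℂ) x, p x → p (c • x))
    (hprod : ∀ x : Fin n → H, p (prodVec x)) (Ψ : TensorPow H n) : p Ψ := by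
  have : Ψ ∈ Submodule.span ℂ (Set.range (prodVec : (Fin n → H) → TensorPow H n)) := by
    rw [span_range_prodVec]; trivial
  induction this using Submodule.span_induction with
  | mem x hx => obtain ⟨y, rfl⟩ := hx; exact hprod y
  | zero => exact h0
  | add x y _ _ hx hy => exact hadd x y hx hy
  | smul c x _ hx => exact hsmul c x hx

/-- The product basis of `H^{⊗n}` given by an orthonormal basis of `H`. -/
noncomputable def prodBasis {ι : Type*} [Fintype ι] [DecidableEq ι] (e : OrthonormalBasis ι ℂ H)
    (n : ℕ) : OrthonormalBasis (Fin n → ι) ℂ (TensorPow H n) :=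
  OrthonormalBasis.mk (v := fun a : Fin n → ι => prodVec fun i => e (a i))
    (by
      rw [orthonormal_iff_ite]
      intro a b
      rw [inner_prodVec_prodVec]
      simp only [orthonormal_iff_ite.1 e.orthonormal]
      rw [Finset.prod_ite_zero]
      simp [funext_iff])
    (by
      have h := (Basis.piTensorProduct (fun _ : Fin n => e.toBasis)).span_eq
      have h' : (fun a : Fin n → ι => (prodVec fun i => e (a i) : TensorPow H n))
          = Basis.piTensorProduct (fun _ : Fin n => e.toBasis) := by
        funext a
        rw [Basis.piTensorProduct_apply]
        simp only [OrthonormalBasis.coe_toBasis]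
        rfl
      rw [h']
      exact h.ge)

theorem prodBasis_apply {ι : Type*} [Fintype ι] [DecidableEq ι] (e : OrthonormalBasis ι ℂ H)
    {n : ℕ} (a : Fin n → ι) : prodBasis e n a = prodVec fun i => e (a i) := by
  simp [prodBasis]

theorem permute_prodBasis {ι : Type*} [Fintype ι] [DecidableEq ι] (e : OrthonormalBasis ι ℂ H)
    {n : ℕ} (π : Equiv.Perm (Fin n)) (a : Fin n → ι) :
    permute π (prodBasis e n a) = prodBasis e n (a ∘ ⇑π⁻¹) := by
  rw [prodBasis_apply, permute_prodVec, prodBasis_apply]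
  rfl

theorem inner_permute {n : ℕ} (π : Equiv.Perm (Fin n)) (Φ Ψ : TensorPow H n) :
    inner ℂ (permute π Φ) (permute π Ψ) = inner ℂ Φ Ψ := by
  induction Φ using induction_prodVec with
  | h0 => simp
  | hadd x y hx hy => simp [inner_add_left, hx, hy]
  | hsmul c x hx => simp [inner_smul_left, hx]
  | hprod x =>
    induction Ψ using induction_prodVec with
    | h0 => simp
    | hadd x y hx hy => simp [inner_add_right, hx, hy]
    | hsmul c x hx => simp [inner_smul_right, hx]
    | hprod y =>
      rw [permute_prodVec, permute_prodVec, inner_prodVec_prodVec, inner_prodVec_prodVec]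
      exact Equiv.prod_comp π⁻¹ fun i => inner ℂ (x i) (y i)

theorem inner_mulEquiv {a b : ℕ} (x x' : TensorPow H a) (y y' : TensorPow H b) :
    inner ℂ (mulEquiv a b (x ⊗ₜ[ℂ] y)) (mulEquiv a b (x' ⊗ₜ[ℂ] y'))
      = inner ℂ x x' * inner ℂ y y' := by
  induction x using induction_prodVec with
  | h0 => simp
  | hadd x₁ x₂ h₁ h₂ => simp [TensorProduct.add_tmul, inner_add_left, h₁, h₂, add_mul]
  | hsmul c x h =>
    rw [← TensorProduct.smul_tmul', map_smul, inner_smul_left, inner_smul_left, h, mul_assoc]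
  | hprod x =>
  induction x' using induction_prodVec with
  | h0 => simp
  | hadd x₁ x₂ h₁ h₂ => simp [TensorProduct.add_tmul, inner_add_right, h₁, h₂, add_mul]
  | hsmul c x h =>
    rw [← TensorProduct.smul_tmul', map_smul, inner_smul_right, inner_smul_right, h, mul_assoc]
  | hprod x' =>
  induction y using induction_prodVec with
  | h0 => simp
  | hadd x₁ x₂ h₁ h₂ => simp [TensorProduct.tmul_add, inner_add_left, h₁, h₂, mul_add]
  | hsmul c x h =>
    rw [TensorProduct.tmul_smul, map_smul, inner_smul_left, inner_smul_left, h, mul_left_comm]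
  | hprod y =>
  induction y' using induction_prodVec with
  | h0 => simp
  | hadd x₁ x₂ h₁ h₂ => simp [TensorProduct.tmul_add, inner_add_right, h₁, h₂, mul_add]
  | hsmul c x h =>
    rw [TensorProduct.tmul_smul, map_smul, inner_smul_right, inner_smul_right, h, mul_left_comm]
  | hprod y' =>
    simp only [mulEquiv_prodVec, inner_prodVec_prodVec, Fin.prod_univ_add, Fin.append_left,
      Fin.append_right]

/-- The contraction `1 ⊗ ⟨φ|` of the last `k` subsystems with a vector `φ`. -/
noncomputable def contract (n : ℕ) {k : ℕ} (φ : TensorPow H k) :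
    TensorPow H (n + k) →ₗ[ℂ] TensorPow H n :=
  (TensorProduct.rid ℂ (TensorPow H n)).toLinearMap ∘ₗ
    (LinearMap.lTensor _ (innerSL ℂ φ).toLinearMap) ∘ₗ (mulEquiv n k).symm.toLinearMap

theorem contract_mulEquiv {n k : ℕ} (φ : TensorPow H k) (x : TensorPow H n) (y : TensorPow H k) :
    contract n φ (mulEquiv n k (x ⊗ₜ[ℂ] y)) = inner ℂ φ y • x := by
  simp [contract]

/-- The vectors of `H^{⊗(n+k)}` can be treated as sums of tensors `x ⊗ y`. -/
theorem induction_mulEquiv {n k : ℕ} {p : TensorPow H (n + k) → Prop} (h0 : p 0)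
    (hadd : ∀ x y, p x → p y → p (x + y))
    (htmul : ∀ x y, p (mulEquiv n k (x ⊗ₜ[ℂ] y))) (Ψ : TensorPow H (n + k)) : p Ψ := by
  rw [← (mulEquiv n k).apply_symm_apply Ψ]
  induction (mulEquiv n k).symm Ψ using TensorProduct.induction_on with
  | zero => simpa using h0
  | tmul x y => exact htmul x y
  | add x y hx hy => rw [map_add]; exact hadd _ _ hx hy

theorem inner_contract {n k : ℕ} (φ : TensorPow H k) (ξ : TensorPow H n)
    (Ψ : TensorPow H (n + k)) :
    inner ℂ ξ (contract n φ Ψ) = inner ℂ (mulEquiv n k (ξ ⊗ₜ[ℂ] φ)) Ψ := by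
  induction Ψ using induction_mulEquiv with
  | h0 => simp
  | hadd x y hx hy => simp [inner_add_right, hx, hy]
  | htmul x y => rw [contract_mulEquiv, inner_mulEquiv, inner_smul_right, mul_comm]

theorem partialTrace_add {n k : ℕ} (S T : TensorPow H (n + k) →L[ℂ] TensorPow H (n + k)) :
    partialTrace n k (S + T) = partialTrace n k S + partialTrace n k T := by
  simp [partialTrace]

theorem partialTrace_zero {n k : ℕ} :
    partialTrace n k (0 : TensorPow H (n + k) →L[ℂ] TensorPow H (n + k)) = 0 := by
  simp [partialTrace]

open InnerProductSpace in
theorem partialTrace_rankOne_mulEquiv {n k : ℕ} (x x' : TensorPow H n) (y y' : TensorPow H k) :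
    partialTrace n k (rankOne ℂ (mulEquiv n k (x ⊗ₜ[ℂ] y)) (mulEquiv n k (x' ⊗ₜ[ℂ] y')))
      = inner ℂ y' y • rankOne ℂ x x' := by
  have h : rankOne ℂ (mulEquiv n k (x ⊗ₜ[ℂ] y)) (mulEquiv n k (x' ⊗ₜ[ℂ] y'))
      = LinearMap.toContinuousLinearMap ((mulEquiv n k).conj
          (TensorProduct.map (rankOne ℂ x x').toLinearMap (rankOne ℂ y y').toLinearMap)) := by
    ext Ψ
    induction Ψ using induction_mulEquiv with
    | h0 => simp
    | hadd u v hu hv => simp only [map_add, hu, hv]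
    | htmul u v =>
      simp only [rankOne_apply, inner_mulEquiv, LinearMap.coe_toContinuousLinearMap',
        LinearEquiv.conj_apply, LinearMap.comp_apply, LinearEquiv.coe_coe,
        LinearEquiv.symm_apply_apply, TensorProduct.map_tmul, ContinuousLinearMap.coe_coe]
      rw [TensorProduct.tmul_smul, ← TensorProduct.smul_tmul', smul_smul, map_smul, mul_comm]
  rw [h, partialTrace_tensor, InnerProductSpace.trace_rankOne]
  rfl

/-- The permutation of `n + k` subsystems that permutes the last `k` of them. -/
def permLast (n : ℕ) {k : ℕ} (π : Equiv.Perm (Fin k)) : Equiv.Perm (Fin (n + k)) :=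
  finSumFinEquiv.permCongr (Equiv.Perm.sumCongr 1 π)

/-- The permutation of `n + k` subsystems that permutes the first `n` of them. -/
def permFirst {n : ℕ} (k : ℕ) (π : Equiv.Perm (Fin n)) : Equiv.Perm (Fin (n + k)) :=
  finSumFinEquiv.permCongr (Equiv.Perm.sumCongr π 1)

theorem append_comp_permFirst {n k : ℕ} {α : Type*} (π : Equiv.Perm (Fin n)) (x : Fin n → α)
    (y : Fin k → α) : Fin.append x y ∘ permFirst k π = Fin.append (x ∘ π) y := by
  funext i
  refine Fin.addCases (fun i => ?_) (fun i => ?_) i <;> simp [permFirst]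

theorem permute_permLast_mulEquiv {n k : ℕ} (π : Equiv.Perm (Fin k)) (x : TensorPow H n)
    (y : TensorPow H k) :
    permute (permLast n π) (mulEquiv n k (x ⊗ₜ[ℂ] y)) = mulEquiv n k (x ⊗ₜ[ℂ] permute π y) := by
  induction x using induction_prodVec with
  | h0 => simp
  | hadd x₁ x₂ h₁ h₂ => simp [TensorProduct.add_tmul, h₁, h₂]
  | hsmul c x h =>
    rw [← TensorProduct.smul_tmul', map_smul, map_smul, h, ← TensorProduct.smul_tmul', map_smul]
  | hprod x =>
  induction y using induction_prodVec with
  | h0 => simp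
  | hadd x₁ x₂ h₁ h₂ => simp [TensorProduct.tmul_add, h₁, h₂]
  | hsmul c x h => simp [TensorProduct.tmul_smul, h]
  | hprod y =>
    rw [permute_prodVec, mulEquiv_prodVec, mulEquiv_prodVec, permute_prodVec]
    have h1 : ∀ i, (permLast n π)⁻¹ (Fin.castAdd k i) = Fin.castAdd k i := fun i => by
      rw [Equiv.Perm.inv_eq_iff_eq]; simp [permLast]
    have h2 : ∀ i, (permLast n π)⁻¹ (Fin.natAdd n i) = Fin.natAdd n (π⁻¹ i) := fun i => by
      rw [Equiv.Perm.inv_eq_iff_eq]; simp [permLast]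
    congr 1
    funext i
    refine Fin.addCases (fun i => ?_) (fun i => ?_) i
    · rw [h1, Fin.append_left, Fin.append_left]
    · rw [h2, Fin.append_right, Fin.append_right]

end Contraction

/-! ### The partial trace of a symmetric pure state -/

section PartialTrace

open InnerProductSpace

variable {H : Type*} [NormedAddCommGroup H] [InnerProductSpace ℂ H] [FiniteDimensional ℂ H]

/-- Finitely many weighted unit vectors of `H` resolve the identity of `Sym(H^{⊗k})` by their
`k`-th tensor powers. -/
structure SymResolution (H : Type*) [NormedAddCommGroup H] [InnerProductSpace ℂ H]
    [FiniteDimensional ℂ H] (k : ℕ) where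
  /-- The indices of the vectors. -/
  J : Type
  [fintype : Fintype J]
  /-- The weights. -/
  w : J → ℝ
  /-- The unit vectors. -/
  θ : J → H
  w_nonneg : ∀ j, 0 ≤ w j
  norm_θ : ∀ j, ‖θ j‖ = 1
  /-- The weighted sum of the `|θ⟩⟨θ|^{⊗k}` is the average of all permutations. -/
  resolution : ∀ φ : TensorPow H k,
    ∑ j, (w j : ℂ) • inner ℂ (prodVec fun _ : Fin k => θ j) φ • prodVec (fun _ : Fin k => θ j)
      = (k.factorial : ℂ)⁻¹ • ∑ π : Equiv.Perm (Fin k), permute π φ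
  /-- The total weight is at most the dimension of `Sym(H^{⊗k})`. -/
  sum_w_le : ∑ j, w j ≤ Nat.multichoose (Module.finrank ℂ H) k

attribute [instance] SymResolution.fintype

theorem nonempty_symResolution {k : ℕ} (hk : 1 ≤ k) (hd : 1 ≤ Module.finrank ℂ H) :
    Nonempty (SymResolution H k) := by
  have : Nonempty (Fin k) := ⟨⟨0, hk⟩⟩
  have : Nonempty (Fin (Module.finrank ℂ H)) := ⟨⟨0, hd⟩⟩
  obtain ⟨J, hJ, w, x, hw, hx, hq⟩ := exists_symmetric_quadrature (Fin k) (Fin (Module.finrank ℂ H))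
  let e := stdOrthonormalBasis ℂ H
  let θ (j : J) : H := e.repr.symm (x j)
  have hin : ∀ j a, inner ℂ (prodBasis e k a) (prodVec fun _ => θ j) = ∏ i, x j (a i) := by
    intro j a
    rw [prodBasis_apply, inner_prodVec_prodVec]
    refine Finset.prod_congr rfl fun i _ => ?_
    rw [← OrthonormalBasis.repr_apply_apply]
    simp [θ]
  have hin' : ∀ j b, inner ℂ (prodVec fun _ => θ j) (prodBasis e k b)
      = ∏ i, (starRingEnd ℂ) (x j (b i)) := by
    intro j b
    rw [← inner_conj_symm, hin, map_prod]
  refine ⟨⟨J, w, θ, hw, fun j => by simp [θ, hx], fun φ => ?_, ?_⟩⟩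
  · have key : ∑ j, (w j : ℂ) • (rankOne ℂ (prodVec fun _ : Fin k => θ j)
        (prodVec fun _ : Fin k => θ j)).toLinearMap
        = (k.factorial : ℂ)⁻¹ • ∑ π : Equiv.Perm (Fin k), (permute (H := H) π).toLinearMap := by
      refine (prodBasis e k).toBasis.ext fun b => ?_
      refine ext_inner_left_basis (𝕜 := ℂ) (prodBasis e k).toBasis fun a => ?_
      simp only [OrthonormalBasis.coe_toBasis, LinearMap.sum_apply, LinearMap.smul_apply,
        ContinuousLinearMap.coe_coe, rankOne_apply, inner_sum, inner_smul_right, hin, hin',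
        LinearEquiv.coe_coe]
      have h1 : ∀ π : Equiv.Perm (Fin k),
          inner ℂ (prodBasis e k a) (permute π (prodBasis e k b))
            = if a ∘ π = b then (1 : ℂ) else 0 := by
        intro π
        rw [permute_prodBasis, orthonormal_iff_ite.1 (prodBasis e k).orthonormal]
        refine if_congr ?_ rfl rfl
        constructor
        · rintro rfl; ext i; simp
        · rintro rfl; ext i; simp
      simp_rw [h1]
      rw [Finset.sum_boole, inv_mul_eq_div]
      have := hq a b
      rw [Fintype.card_fin] at this
      rw [numPerm] at this
      rw [← this]
      refine Finset.sum_congr rfl fun j _ => ?_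
      rw [Finset.prod_mul_distrib]
      ring
    have := LinearMap.congr_fun key φ
    simpa using this
  · have h2 : ∀ j, ∑ a : Fin k → Fin (Module.finrank ℂ H),
        ∏ i, x j (a i) * (starRingEnd ℂ) (x j (a i)) = 1 := by
      intro j
      have h := (prodBasis e k).sum_inner_mul_inner (prodVec fun _ => θ j) (prodVec fun _ => θ j)
      simp only [hin, hin', ← Finset.prod_mul_distrib] at h
      rw [inner_prodVec_prodVec] at h
      simp only [mul_comm (x j _)]
      rw [h]
      simp [θ, inner_self_eq_norm_sq_to_K, hx]
    have h3 : ((∑ j, w j : ℝ) : ℂ)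
        = ((∑ a : Fin k → Fin (Module.finrank ℂ H), numPerm a a : ℕ) : ℂ) / k.factorial := by
      push_cast
      rw [Finset.sum_div]
      have := fun a : Fin k → Fin (Module.finrank ℂ H) => hq a a
      simp only [Fintype.card_fin] at this
      simp_rw [← this]
      rw [Finset.sum_comm]
      refine Finset.sum_congr rfl fun j _ => ?_
      rw [← Finset.mul_sum, h2, mul_one]
    have h4 : (∑ j, w j)
        = ((∑ a : Fin k → Fin (Module.finrank ℂ H), numPerm a a : ℕ) : ℝ) / k.factorial := by
      apply Complex.ofReal_injective
      push_cast at h3 ⊢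
      exact h3
    rw [h4, div_le_iff₀ (by positivity)]
    have := sum_numPerm_self_le (κ := Fin k) (ι := Fin (Module.finrank ℂ H))
    rw [Fintype.card_fin, Fintype.card_fin] at this
    exact_mod_cast this

theorem average_permLast_eq_self {n k : ℕ} {Ψ : TensorPow H (n + k)}
    (hΨ : Ψ ∈ symSubspace H (n + k)) :
    (k.factorial : ℂ)⁻¹ • ∑ π : Equiv.Perm (Fin k), permute (permLast n π) Ψ = Ψ := by
  rw [Finset.sum_congr rfl fun π _ => hΨ (permLast n π), Finset.sum_const, Finset.card_univ,
    Fintype.card_perm, Fintype.card_fin, ← Nat.cast_smul_eq_nsmul ℂ, smul_smul,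
    inv_mul_cancel₀ (by exact_mod_cast k.factorial_ne_zero), one_smul]

theorem SymResolution.sum_rankOne_contract {n k : ℕ} (R : SymResolution H k)
    (Ψ Ψ' : TensorPow H (n + k)) :
    ∑ j, (R.w j : ℂ) • rankOne ℂ (contract n (prodVec fun _ : Fin k => R.θ j) Ψ)
        (contract n (prodVec fun _ : Fin k => R.θ j) Ψ')
      = partialTrace n k (rankOne ℂ
          ((k.factorial : ℂ)⁻¹ • ∑ π : Equiv.Perm (Fin k), permute (permLast n π) Ψ) Ψ') := by
  induction Ψ using induction_mulEquiv with
  | h0 => simp [partialTrace_zero]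
  | hadd u v hu hv =>
    simp only [map_add, smul_add, Finset.sum_add_distrib, add_apply,
      partialTrace_add, hu, hv]
  | htmul x y =>
  induction Ψ' using induction_mulEquiv with
  | h0 => simp [partialTrace_zero]
  | hadd u v hu hv =>
    simp only [map_add, smul_add, Finset.sum_add_distrib, partialTrace_add, hu, hv]
  | htmul x' y' =>
    simp only [permute_permLast_mulEquiv]
    rw [← map_sum, ← TensorProduct.tmul_sum, ← map_smul, ← TensorProduct.tmul_smul,
      ← R.resolution, partialTrace_rankOne_mulEquiv]
    simp only [contract_mulEquiv, inner_sum, inner_smul_right, Finset.sum_smul, map_smul,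
      smul_apply, map_smulₛₗ, smul_smul, inner_conj_symm]
    refine Finset.sum_congr rfl fun j _ => ?_
    congr 1
    ring

/-- Resolving the identity on the last `k` subsystems writes `tr_k |Ψ⟩⟨Ψ|` as a sum of pure
states. -/
theorem SymResolution.partialTrace_rankOne_self {n k : ℕ} (R : SymResolution H k)
    {Ψ : TensorPow H (n + k)} (hΨ : Ψ ∈ symSubspace H (n + k)) :
    partialTrace n k (rankOne ℂ Ψ Ψ)
      = ∑ j, (R.w j : ℂ) • rankOne ℂ (contract n (prodVec fun _ : Fin k => R.θ j) Ψ)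
        (contract n (prodVec fun _ : Fin k => R.θ j) Ψ) := by
  rw [R.sum_rankOne_contract, average_permLast_eq_self hΨ]

theorem trace_partialTrace_rankOne {n k : ℕ} (Ψ Ψ' : TensorPow H (n + k)) :
    LinearMap.trace ℂ _ (partialTrace n k (rankOne ℂ Ψ Ψ')).toLinearMap = inner ℂ Ψ' Ψ := by
  induction Ψ using induction_mulEquiv with
  | h0 => simp [partialTrace_zero]
  | hadd u v hu hv => simp [partialTrace_add, inner_add_right, hu, hv]
  | htmul x y =>
  induction Ψ' using induction_mulEquiv with
  | h0 => simp [partialTrace_zero]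
  | hadd u v hu hv => simp [partialTrace_add, inner_add_left, hu, hv]
  | htmul x' y' =>
    rw [partialTrace_rankOne_mulEquiv, inner_mulEquiv]
    simp [trace_rankOne, mul_comm]

theorem SymResolution.sum_norm_sq_contract {n k : ℕ} (R : SymResolution H k)
    {Ψ : TensorPow H (n + k)} (hΨ : Ψ ∈ symSubspace H (n + k)) :
    ∑ j, R.w j * ‖contract n (prodVec fun _ : Fin k => R.θ j) Ψ‖ ^ 2 = ‖Ψ‖ ^ 2 := by
  have h := trace_partialTrace_rankOne (n := n) (k := k) Ψ Ψ
  rw [R.partialTrace_rankOne_self hΨ] at h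
  simp only [ContinuousLinearMap.toLinearMap_sum, ContinuousLinearMap.toLinearMap_smul, map_sum,
    map_smul, trace_rankOne, inner_self_eq_norm_sq_to_K, smul_eq_mul] at h
  apply Complex.ofReal_injective
  push_cast
  exact h

end PartialTrace

end TensorPow

/-! ### Deviating labels after conditioning on some positions -/

section Tail

variable {κ ι : Type*} [Fintype κ] [DecidableEq κ] [Fintype ι] [DecidableEq ι]

/-- The total weight of the labellings that carry the label `o` on `T` and have at least `s` labels
different from `o`. -/
def tailWeight (o : ι) (s : ℕ) (f : (κ → ι) → ℝ) (T : Finset κ) : ℝ :=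
  ∑ b with s ≤ (Finset.univ.filter fun i => b i ≠ o).card ∧ ∀ i ∈ T, b i = o, f b

theorem tailWeight_nonneg {o : ι} {s : ℕ} {f : (κ → ι) → ℝ} (hf : ∀ b, 0 ≤ f b) (T : Finset κ) :
    0 ≤ tailWeight o s f T :=
  Finset.sum_nonneg fun b _ => hf b

theorem sum_le_tailWeight {o : ι} {s : ℕ} {f : (κ → ι) → ℝ} (hf : ∀ b, 0 ≤ f b) {T : Finset κ}
    {S : Finset (κ → ι)}
    (hS : ∀ b ∈ S, s ≤ (Finset.univ.filter fun i => b i ≠ o).card ∧ ∀ i ∈ T, b i = o) :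
    ∑ b ∈ S, f b ≤ tailWeight o s f T :=
  Finset.sum_le_sum_of_subset_of_nonneg
    (fun b hb => Finset.mem_filter.2 ⟨Finset.mem_univ _, hS b hb⟩) fun b _ _ => hf b

theorem tailWeight_insert_eq {o : ι} {s : ℕ} {f : (κ → ι) → ℝ}
    (hsym : ∀ b (π : Equiv.Perm κ), f (b ∘ π) = f b) {T : Finset κ} {p q : κ} (hp : p ∉ T)
    (hq : q ∉ T) : tailWeight o s f (insert p T) = tailWeight o s f (insert q T) := by
  have hcard : ∀ b : κ → ι, (Finset.univ.filter fun i => (b ∘ Equiv.swap p q) i ≠ o).card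
      = (Finset.univ.filter fun i => b i ≠ o).card := fun b =>
    Finset.card_equiv (Equiv.swap p q) fun i => by simp
  simp only [Function.comp_apply] at hcard
  have hT : ∀ i ∈ T, Equiv.swap p q i = i := fun i hi =>
    Equiv.swap_apply_of_ne_of_ne (fun h => hp (h ▸ hi)) fun h => hq (h ▸ hi)
  refine Finset.sum_equiv (Equiv.arrowCongr (Equiv.swap p q) (Equiv.refl ι)) (fun b => ?_)
    fun b _ => (hsym b _).symm
  have hb : Equiv.arrowCongr (Equiv.swap p q) (Equiv.refl ι) b = b ∘ Equiv.swap p q := by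
    ext i; simp [Equiv.arrowCongr]
  rw [hb]
  simp only [Finset.mem_filter, Finset.mem_univ, true_and, hcard, Finset.mem_insert,
    forall_eq_or_imp, Function.comp_apply, Equiv.swap_apply_right]
  refine and_congr_right fun _ => and_congr_right fun _ => forall₂_congr fun i hi => ?_
  rw [hT i hi]

/-- Each of the labellings counted has at least `s` of its positions outside `T` labelled
differently from `o`, and all these positions are alike. -/
theorem card_mul_tailWeight_insert_le {o : ι} {s : ℕ} {f : (κ → ι) → ℝ} (hf : ∀ b, 0 ≤ f b)
    (hsym : ∀ b (π : Equiv.Perm κ), f (b ∘ π) = f b) {T : Finset κ} {q : κ} (hq : q ∉ T) :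
    (Fintype.card κ : ℝ) * tailWeight o s f (insert q T)
      ≤ ((Fintype.card κ : ℝ) - s) * tailWeight o s f T := by
  have hsub : tailWeight o s f (insert q T) ≤ tailWeight o s f T :=
    Finset.sum_le_sum_of_subset_of_nonneg
      (Finset.monotone_filter_right _ fun b _ h =>
        ⟨h.1, fun i hi => h.2 i (Finset.mem_insert_of_mem hi)⟩) fun b _ _ => hf b
  have hcompl : (Tᶜ.card : ℝ) = (Fintype.card κ : ℝ) - T.card := by
    rw [Finset.card_compl, Nat.cast_sub (Finset.card_le_univ T)]
  have h1 : ((Tᶜ.card : ℕ) : ℝ) * tailWeight o s f (insert q T)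
      = ∑ p ∈ Tᶜ, tailWeight o s f (insert p T) := by
    rw [← nsmul_eq_mul, ← Finset.sum_const]
    exact Finset.sum_congr rfl fun p hp =>
      tailWeight_insert_eq hsym hq (Finset.mem_compl.1 hp)
  have h2 : ∑ p ∈ Tᶜ, tailWeight o s f (insert p T)
      ≤ ((Tᶜ.card : ℝ) - s) * tailWeight o s f T := by
    have h3 : ∀ p, tailWeight o s f (insert p T) =
        ∑ b with s ≤ (Finset.univ.filter fun i => b i ≠ o).card ∧ ∀ i ∈ T, b i = o,
          if b p = o then f b else 0 := by
      intro p
      rw [tailWeight, ← Finset.sum_filter, Finset.filter_filter]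
      refine Finset.sum_congr (Finset.filter_congr fun b _ => ?_) fun _ _ => rfl
      rw [Finset.forall_mem_insert]
      tauto
    simp_rw [h3]
    rw [Finset.sum_comm, tailWeight, Finset.mul_sum]
    refine Finset.sum_le_sum fun b hb => ?_
    obtain ⟨hs, hbT⟩ := (Finset.mem_filter.1 hb).2
    rw [← Finset.sum_filter, Finset.sum_const, nsmul_eq_mul]
    refine mul_le_mul_of_nonneg_right ?_ (hf b)
    have h4 := Finset.card_filter_add_card_filter_not (s := Tᶜ) (fun p => b p = o)
    have h5 : Tᶜ.filter (fun p => ¬ b p = o) = Finset.univ.filter fun i => b i ≠ o := by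
      ext i
      simp only [Finset.mem_filter, Finset.mem_compl, Finset.mem_univ, true_and, ne_eq,
        and_iff_right_iff_imp]
      exact fun hi hiT => hi (hbT i hiT)
    rw [h5] at h4
    have h6 : (Tᶜ.filter fun p => b p = o).card + s ≤ Tᶜ.card := by omega
    have h7 : (((Tᶜ.filter fun p => b p = o).card : ℕ) : ℝ) + s ≤ Tᶜ.card := by exact_mod_cast h6
    linarith
  rw [hcompl] at h1 h2
  have h8 : (T.card : ℝ) * tailWeight o s f (insert q T) ≤ T.card * tailWeight o s f T :=
    mul_le_mul_of_nonneg_left hsub (Nat.cast_nonneg _)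
  linarith

theorem tailWeight_le {o : ι} {s : ℕ} {f : (κ → ι) → ℝ} (hf : ∀ b, 0 ≤ f b)
    (hsym : ∀ b (π : Equiv.Perm κ), f (b ∘ π) = f b) (T : Finset κ) :
    tailWeight o s f T
      ≤ Real.exp (-((T.card : ℝ) * s) / Fintype.card κ) * ∑ b, f b := by
  induction T using Finset.induction_on with
  | empty =>
    simp only [Finset.card_empty, Nat.cast_zero, zero_mul, neg_zero, zero_div, Real.exp_zero,
      one_mul]
    exact Finset.sum_le_sum_of_subset_of_nonneg (Finset.subset_univ _) fun b _ _ => hf b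
  | insert q T hq ih =>
    have hN : 0 < (Fintype.card κ : ℝ) := by
      exact_mod_cast Fintype.card_pos_iff.2 ⟨q⟩
    have h1 := card_mul_tailWeight_insert_le (o := o) (s := s) hf hsym hq
    have h2 : tailWeight o s f (insert q T)
        ≤ (1 - (s : ℝ) / Fintype.card κ) * tailWeight o s f T := by
      rw [one_sub_div hN.ne', div_mul_eq_mul_div, le_div_iff₀ hN, mul_comm]
      exact h1
    have h3 := Real.one_sub_le_exp_neg ((s : ℝ) / Fintype.card κ)
    calc tailWeight o s f (insert q T)
        ≤ Real.exp (-((s : ℝ) / Fintype.card κ)) * tailWeight o s f T :=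
          h2.trans (mul_le_mul_of_nonneg_right h3 (tailWeight_nonneg hf T))
      _ ≤ Real.exp (-((s : ℝ) / Fintype.card κ)) *
          (Real.exp (-((T.card : ℝ) * s) / Fintype.card κ) * ∑ b, f b) :=
          mul_le_mul_of_nonneg_left ih (Real.exp_pos _).le
      _ = _ := by
          rw [← mul_assoc, ← Real.exp_add, Finset.card_insert_of_notMem hq]
          congr 2
          push_cast
          ring

theorem sum_append_le {o : ι} {n k s : ℕ} {f : (Fin (n + k) → ι) → ℝ} (hf : ∀ b, 0 ≤ f b)
    (hsym : ∀ b (π : Equiv.Perm (Fin (n + k))), f (b ∘ π) = f b) :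
    ∑ a : Fin n → ι with s ≤ (Finset.univ.filter fun i => a i ≠ o).card,
        f (Fin.append a fun _ => o)
      ≤ Real.exp (-((k : ℝ) * s) / ((n : ℝ) + k)) * ∑ b, f b := by
  have hinj : Function.Injective fun a : Fin n → ι => Fin.append a fun _ : Fin k => o := by
    intro a a' h
    funext i
    simpa using congrFun h (Fin.castAdd k i)
  have h := tailWeight_le (o := o) (s := s) hf hsym (Finset.univ.map (Fin.natAddEmb n))
  rw [Finset.card_map, Finset.card_univ, Fintype.card_fin, Fintype.card_fin] at h
  push_cast at h
  refine le_trans ?_ h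
  rw [← Finset.sum_image (f := f) (g := fun a : Fin n → ι => Fin.append a fun _ : Fin k => o)
    hinj.injOn]
  refine sum_le_tailWeight hf fun b hb => ?_
  obtain ⟨a, ha, rfl⟩ := Finset.mem_image.1 hb
  refine ⟨(Finset.mem_filter.1 ha).2.trans ?_, ?_⟩
  · refine Finset.card_le_card_of_injOn (Fin.castAdd k) (fun i hi => ?_)
      (Fin.castAdd_injective n k).injOn
    simpa using hi
  · intro i hi
    obtain ⟨j, -, rfl⟩ := Finset.mem_map.1 hi
    simp

end Tail

/-! ### The symmetric subspace along a product vector -/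

namespace TensorPow

variable {H : Type*} [NormedAddCommGroup H] [InnerProductSpace ℂ H] [FiniteDimensional ℂ H]

theorem castEquiv_prodVec {a b : ℕ} (h : a = b) (x : Fin a → H) :
    castEquiv h (prodVec x) = prodVec (x ∘ Fin.cast h.symm) := by
  subst h
  simp only [castEquiv, prodVec, LinearEquiv.trans_apply, LinearEquiv.apply_symm_apply]
  exact congrArg _ (TensorPower.cast_tprod ℂ H rfl x)

theorem prodVec_mem_alongSet {m n : ℕ} (h : m ≤ n) {θ : H} {x : Fin n → H} {U : Finset (Fin n)}
    (hU : U.card = m) (hx : ∀ i ∈ U, x i = θ) : prodVec x ∈ alongSet h θ := by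
  have hcard : Fintype.card {i : Fin n // (i : ℕ) < m} = Fintype.card {i // i ∈ U} := by
    rw [Fintype.card_coe, hU, Fintype.card_subtype]
    rw [Fin.card_filter_val_lt, min_eq_right h]
  let e := Fintype.equivOfCardEq hcard
  let g : Equiv.Perm (Fin n) := e.extendSubtype
  have hg : ∀ i : Fin n, (i : ℕ) < m → x (g i) = θ := fun i hi =>
    hx _ (e.extendSubtype_mem i hi)
  refine ⟨g, prodVec fun i => x (g (Fin.cast (Nat.add_sub_of_le h) (Fin.natAdd m i))), ?_⟩
  rw [mulEquiv_prodVec, castEquiv_prodVec, permute_prodVec]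
  have h1 : Fin.append (fun _ : Fin m => θ)
      (fun i => x (g (Fin.cast (Nat.add_sub_of_le h) (Fin.natAdd m i))))
      = fun i => x (g (Fin.cast (Nat.add_sub_of_le h) i)) := by
    funext i
    refine Fin.addCases (fun i => ?_) (fun i => ?_) i
    · rw [Fin.append_left, hg _ (by simp)]
    · rw [Fin.append_right]
  rw [h1]
  congr 1
  funext i
  simp

theorem prodVec_const_mem_symSubspaceAlong {m n : ℕ} (h : m ≤ n) (θ : H) :
    prodVec (fun _ => θ) ∈ symSubspaceAlong h θ := by
  refine ⟨fun π => permute_prodVec π _, Submodule.subset_span ?_⟩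
  obtain ⟨U, -, hU⟩ := Finset.exists_subset_card_eq (s := (Finset.univ : Finset (Fin n))) (n := m)
    (by simpa using h)
  exact prodVec_mem_alongSet h hU fun _ _ => rfl

theorem norm_prodVec_const {θ : H} (hθ : ‖θ‖ = 1) (n : ℕ) :
    ‖(prodVec fun _ : Fin n => θ)‖ = 1 := by
  have h := inner_prodVec_prodVec (fun _ : Fin n => θ) fun _ => θ
  rw [inner_self_eq_norm_sq_to_K, inner_self_eq_norm_sq_to_K, hθ] at h
  have h2 : ‖(prodVec fun _ : Fin n => θ)‖ ^ 2 = 1 := by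
    apply Complex.ofReal_injective
    push_cast
    simpa using h
  exact (pow_eq_one_iff_of_nonneg (norm_nonneg _) two_ne_zero).1 h2

/-- The truncation keeps the basis vectors with at most `r` factors different from `θ`; by
`sum_append_le` little is lost after `k` further subsystems have been found in the state `θ`. -/
theorem exists_truncation {n k r : ℕ} {Ψ : TensorPow H (n + k)}
    (hΨ : Ψ ∈ symSubspace H (n + k)) {θ : H} (hθ : ‖θ‖ = 1) :
    ∃ Φ ∈ symSubspaceAlong (Nat.sub_le n r) θ,
      inner ℂ Φ (contract n (prodVec fun _ : Fin k => θ) Ψ - Φ) = 0 ∧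
      ‖contract n (prodVec fun _ : Fin k => θ) Ψ - Φ‖ ^ 2
        ≤ Real.exp (-((k : ℝ) * ((r : ℝ) + 1)) / ((n : ℝ) + k)) * ‖Ψ‖ ^ 2 := by
  classical
  have hon : Orthonormal ℂ ((↑) : ({θ} : Set H) → H) := by
    rw [orthonormal_subtype_iff_ite]
    rintro x hx y hy
    rw [Set.mem_singleton_iff.1 hx, Set.mem_singleton_iff.1 hy, if_pos rfl,
      inner_self_eq_norm_sq_to_K, hθ]
    simp
  obtain ⟨u, e, hu, he⟩ := hon.exists_orthonormalBasis_extension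
  let o : u := ⟨θ, hu rfl⟩
  have heo : e o = θ := by rw [he]
  let c (b : Fin (n + k) → u) : ℂ := inner ℂ (prodBasis e (n + k) b) Ψ
  have hc : ∀ b (π : Equiv.Perm (Fin (n + k))), c (b ∘ π) = c b := by
    intro b π
    have h := inner_permute π⁻¹ (prodBasis e (n + k) b) Ψ
    rw [permute_prodBasis, hΨ, inv_inv] at h
    exact h
  set Ψθ := contract n (prodVec fun _ : Fin k => θ) Ψ
  have hΨθ : ∀ a, inner ℂ (prodBasis e n a) Ψθ = c (Fin.append a fun _ => o) := by
    intro a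
    rw [inner_contract, prodBasis_apply, mulEquiv_prodVec]
    simp only [c, prodBasis_apply]
    congr 2
    funext i
    refine Fin.addCases (fun i => ?_) (fun i => ?_) i <;> simp [heo]
  let nz (a : Fin n → u) : ℕ := (Finset.univ.filter fun i => a i ≠ o).card
  let Φ : TensorPow H n := ∑ a, (if nz a ≤ r then c (Fin.append a fun _ => o) else 0) •
    prodBasis e n a
  have hΦ : ∀ a, inner ℂ (prodBasis e n a) Φ
      = if nz a ≤ r then c (Fin.append a fun _ => o) else 0 := fun a =>
    (prodBasis e n).orthonormal.inner_right_fintype _ a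
  have hdiff : ∀ a, inner ℂ (prodBasis e n a) (Ψθ - Φ)
      = if nz a ≤ r then 0 else c (Fin.append a fun _ => o) := by
    intro a
    rw [inner_sub_right, hΨθ, hΦ]
    split_ifs <;> simp
  refine ⟨Φ, ⟨fun π => ?_, ?_⟩, ?_, ?_⟩
  · simp only [Φ, map_sum, map_smul, permute_prodBasis]
    refine Fintype.sum_equiv (Equiv.arrowCongr π (Equiv.refl u)) _ _ fun a => ?_
    have ha : Equiv.arrowCongr π (Equiv.refl u) a = a ∘ ⇑π⁻¹ := by
      ext i; simp [Equiv.arrowCongr]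
    have hnz : nz (a ∘ ⇑π⁻¹) = nz a := (Finset.card_equiv π fun i => by simp).symm
    rw [ha, hnz, ← append_comp_permFirst, hc]
  · refine Submodule.sum_mem _ fun a _ => ?_
    split_ifs with h
    · refine Submodule.smul_mem _ _ (Submodule.subset_span ?_)
      have h1 := Finset.card_filter_add_card_filter_not (s := Finset.univ) (fun i => a i = o)
      rw [Finset.card_univ, Fintype.card_fin] at h1
      obtain ⟨U, hU, hUc⟩ := Finset.exists_subset_card_eq
        (s := Finset.univ.filter fun i => a i = o) (n := n - r)
        (by simp only [nz] at h; simp only [ne_eq] at h; omega)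
      rw [prodBasis_apply]
      refine prodVec_mem_alongSet _ hUc fun i hi => ?_
      rw [(Finset.mem_filter.1 (hU hi)).2, heo]
    · rw [zero_smul]
      exact Submodule.zero_mem _
  · rw [← (prodBasis e n).sum_inner_mul_inner]
    refine Finset.sum_eq_zero fun a _ => ?_
    rw [hdiff, ← inner_conj_symm, hΦ]
    split_ifs <;> simp
  · rw [← (prodBasis e n).sum_sq_norm_inner_right, ← (prodBasis e (n + k)).sum_sq_norm_inner_right]
    have h := sum_append_le (o := o) (s := r + 1) (f := fun b => ‖c b‖ ^ 2)
      (fun b => by positivity) (fun b π => by simp only [hc])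
    push_cast at h
    refine le_trans (le_of_eq ?_) h
    rw [Finset.sum_filter]
    refine Finset.sum_congr rfl fun a _ => ?_
    rw [hdiff]
    by_cases ha : nz a ≤ r
    · rw [if_pos ha, if_neg (by simp only [nz] at ha; omega)]; simp
    · rw [if_neg ha, if_pos (by simp only [nz] at ha; omega)]

end TensorPow

/-! ### Pure states and the trace norm -/

section Operators

open InnerProductSpace

variable {V : Type*} [NormedAddCommGroup V] [InnerProductSpace ℂ V]

theorem norm_abs_apply [CompleteSpace V] (S : V →L[ℂ] V) (x : V) :
    ‖CFC.abs S x‖ = ‖S x‖ := by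
  have hsa : IsSelfAdjoint (CFC.abs S) := (CFC.abs_nonneg S).isSelfAdjoint
  have h : inner ℂ (CFC.abs S x) (CFC.abs S x) = inner ℂ (S x) (S x) := by
    have h1 := congrArg (fun T : V →L[ℂ] V => inner ℂ x (T x)) (CFC.abs_mul_abs S)
    simp only [mul_apply_eq_comp, ContinuousLinearMap.star_eq_adjoint] at h1
    rw [ContinuousLinearMap.adjoint_inner_right] at h1
    rw [← h1]
    exact hsa.isSymmetric x (CFC.abs S x)
  rw [inner_self_eq_norm_sq_to_K, inner_self_eq_norm_sq_to_K] at h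
  have h2 : ‖CFC.abs S x‖ ^ 2 = ‖S x‖ ^ 2 := by
    apply Complex.ofReal_injective
    push_cast
    exact h
  exact (pow_left_inj₀ (norm_nonneg _) (norm_nonneg _) two_ne_zero).1 h2

theorem sum_abs_norm_sq_sub_le {ι : Type*} [Fintype ι] (u : OrthonormalBasis ι ℂ V) (x y : V) :
    ∑ i, |‖inner ℂ (u i) x‖ ^ 2 - ‖inner ℂ (u i) y‖ ^ 2| ≤ ‖x - y‖ * ‖x + y‖ := by
  have h1 : ∀ i, |‖inner ℂ (u i) x‖ ^ 2 - ‖inner ℂ (u i) y‖ ^ 2|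
      ≤ ‖inner ℂ (u i) (x - y)‖ * ‖inner ℂ (u i) (x + y)‖ := by
    intro i
    rw [inner_sub_right, inner_add_right]
    set a : ℂ := inner ℂ (u i) x
    set b : ℂ := inner ℂ (u i) y
    have h : ‖a‖ ^ 2 - ‖b‖ ^ 2 = ((a - b) * (starRingEnd ℂ) (a + b)).re := by
      simp only [← Complex.normSq_eq_norm_sq, Complex.normSq_apply, Complex.mul_re,
        Complex.conj_re, Complex.conj_im, Complex.sub_re, Complex.sub_im, Complex.add_re,
        Complex.add_im]
      ring
    rw [h]
    refine (Complex.abs_re_le_norm _).trans (le_of_eq ?_)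
    rw [norm_mul, RCLike.norm_conj]
  refine (Finset.sum_le_sum fun i _ => h1 i).trans ?_
  refine (Real.sum_mul_le_sqrt_mul_sqrt _ _ _).trans (le_of_eq ?_)
  rw [u.sum_sq_norm_inner_right, u.sum_sq_norm_inner_right, Real.sqrt_sq (norm_nonneg _),
    Real.sqrt_sq (norm_nonneg _)]

/-- Truncating a vector `x` to `Φ` and rescaling to the length of `x` changes the pure state by at
most `2 ‖x‖ ‖x - Φ‖` in trace norm. -/
theorem exists_unit_approximation {W : Submodule ℂ V} {x Φ χ₀ : V} (hΦ : Φ ∈ W) (hχ₀ : χ₀ ∈ W)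
    (hχ₀1 : ‖χ₀‖ = 1) (horth : inner ℂ Φ (x - Φ) = (0 : ℂ)) :
    ∃ χ ∈ W, ‖χ‖ = 1 ∧ ∀ u : OrthonormalBasis (Fin (Module.finrank ℂ V)) ℂ V,
      ∑ i, |‖inner ℂ (u i) x‖ ^ 2 - ‖inner ℂ (u i) ((‖x‖ : ℂ) • χ)‖ ^ 2|
        ≤ 2 * ‖x‖ * ‖x - Φ‖ := by
  by_cases hΦ0 : Φ = 0
  · refine ⟨χ₀, hχ₀, hχ₀1, fun u => ?_⟩
    calc _ ≤ ∑ i, (‖inner ℂ (u i) x‖ ^ 2 + ‖inner ℂ (u i) ((‖x‖ : ℂ) • χ₀)‖ ^ 2) := by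
          refine Finset.sum_le_sum fun i _ => (abs_sub _ _).trans (le_of_eq ?_)
          rw [abs_of_nonneg (by positivity), abs_of_nonneg (by positivity)]
      _ = 2 * ‖x‖ * ‖x - Φ‖ := by
          rw [Finset.sum_add_distrib, u.sum_sq_norm_inner_right, u.sum_sq_norm_inner_right,
            norm_smul, hχ₀1, Complex.norm_real, norm_norm, hΦ0, sub_zero]
          ring
  · have hn : ‖Φ‖ ≠ 0 := norm_ne_zero_iff.2 hΦ0
    have hinner : inner ℂ Φ x = ((‖Φ‖ ^ 2 : ℝ) : ℂ) := by
      rw [inner_sub_right, sub_eq_zero, inner_self_eq_norm_sq_to_K] at horth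
      rw [horth]
      push_cast
      rfl
    let χ : V := ((‖Φ‖⁻¹ : ℝ) : ℂ) • Φ
    have hχ1 : ‖χ‖ = 1 := by
      rw [norm_smul, Complex.norm_real, norm_inv, norm_norm, inv_mul_cancel₀ hn]
    refine ⟨χ, W.smul_mem _ hΦ, hχ1, fun u => (sum_abs_norm_sq_sub_le u _ _).trans ?_⟩
    have hqn : ‖((‖x‖ : ℂ) • χ)‖ = ‖x‖ := by
      rw [norm_smul, hχ1, Complex.norm_real, norm_norm, mul_one]
    have hre : (inner ℂ x ((‖x‖ : ℂ) • χ)).re = ‖x‖ * ‖Φ‖ := by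
      rw [← inner_conj_symm, inner_smul_left, inner_smul_left, hinner, Complex.conj_ofReal,
        Complex.conj_ofReal, ← Complex.ofReal_mul, ← Complex.ofReal_mul, Complex.conj_ofReal,
        Complex.ofReal_re]
      field_simp
    have h1 : ‖x - (‖x‖ : ℂ) • χ‖ ^ 2 = 2 * ‖x‖ ^ 2 - 2 * (‖x‖ * ‖Φ‖) := by
      rw [norm_sub_sq (𝕜 := ℂ), hqn, RCLike.re_eq_complex_re, hre]; ring
    have h2 : ‖x + (‖x‖ : ℂ) • χ‖ ^ 2 = 2 * ‖x‖ ^ 2 + 2 * (‖x‖ * ‖Φ‖) := by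
      rw [norm_add_sq (𝕜 := ℂ), hqn, RCLike.re_eq_complex_re, hre]; ring
    have h3 : ‖x - Φ‖ ^ 2 = ‖x‖ ^ 2 - ‖Φ‖ ^ 2 := by
      rw [norm_sub_sq (𝕜 := ℂ), ← inner_conj_symm, hinner, Complex.conj_ofReal,
        RCLike.re_eq_complex_re, Complex.ofReal_re]
      ring
    refine abs_le_of_sq_le_sq' ?_ (by positivity) |>.2
    rw [mul_pow, h1, h2, mul_pow, h3]
    apply le_of_eq
    ring

variable [FiniteDimensional ℂ V]

theorem isPureDensityOperatorOn_rankOne [CompleteSpace V] {W : Submodule ℂ V} {χ : V} (hχ : χ ∈ W)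
    (h1 : ‖χ‖ = 1) : IsPureDensityOperatorOn W (rankOne ℂ χ χ) := by
  have hχ0 : χ ≠ 0 := norm_ne_zero_iff.1 (by rw [h1]; exact one_ne_zero)
  have hrange : LinearMap.range (rankOne ℂ χ χ).toLinearMap = Submodule.span ℂ {χ} := by
    apply le_antisymm
    · rintro _ ⟨x, rfl⟩
      exact Submodule.smul_mem _ _ (Submodule.mem_span_singleton_self χ)
    · rw [Submodule.span_singleton_le_iff_mem]
      refine ⟨χ, ?_⟩
      simp [inner_self_eq_norm_sq_to_K, h1]
  refine ⟨⟨isPositive_rankOne_self χ, ?_⟩, ?_, ?_⟩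
  · rw [trace_rankOne, inner_self_eq_norm_sq_to_K, h1]
    simp
  · rw [hrange, finrank_span_singleton hχ0]
  · rw [hrange, Submodule.span_singleton_le_iff_mem]
    exact hχ

theorem IsPureDensityOperatorOn.exists_eq_rankOne [CompleteSpace V] {W : Submodule ℂ V}
    {ρ : V →L[ℂ] V} (h : IsPureDensityOperatorOn W ρ) :
    ∃ Ψ ∈ W, ‖Ψ‖ = 1 ∧ ρ = rankOne ℂ Ψ Ψ := by
  obtain ⟨⟨hpos, htr⟩, hrank, hW⟩ := h
  obtain ⟨⟨v, hv⟩, hv0, hspan⟩ := finrank_eq_one_iff'.1 hrank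
  have hv0' : v ≠ 0 := fun h => hv0 (Subtype.ext h)
  have hn : ‖v‖ ≠ 0 := norm_ne_zero_iff.2 hv0'
  let Ψ : V := ((‖v‖⁻¹ : ℝ) : ℂ) • v
  have hΨ1 : ‖Ψ‖ = 1 := by
    rw [norm_smul, Complex.norm_real, norm_inv, norm_norm, inv_mul_cancel₀ hn]
  have hΨW : Ψ ∈ W := W.smul_mem _ (hW hv)
  have hvΨ : v = (‖v‖ : ℂ) • Ψ := by
    rw [smul_smul, ← Complex.ofReal_mul, mul_inv_cancel₀ hn, Complex.ofReal_one, one_smul]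
  have hΨΨ : inner ℂ Ψ Ψ = (1 : ℂ) := by
    rw [inner_self_eq_norm_sq_to_K, hΨ1]; simp
  have hρ : ∀ x, ρ x = inner ℂ Ψ (ρ x) • Ψ := by
    intro x
    obtain ⟨c, hc⟩ := hspan ⟨ρ x, ⟨x, rfl⟩⟩
    have hc' : c • v = ρ x := congrArg Subtype.val hc
    rw [← hc', hvΨ, smul_smul, inner_smul_right, hΨΨ, mul_one]
  have hsym : ∀ x y, inner ℂ (ρ x) y = inner ℂ x (ρ y) := hpos.isSymmetric
  let a : ℂ := inner ℂ (ρ Ψ) Ψ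
  have hρ' : ρ = a • rankOne ℂ Ψ Ψ := by
    ext x
    rw [hρ x, ← hsym, hρ Ψ]
    simp only [inner_smul_left, smul_apply, rankOne_apply, smul_smul, a]
    rw [inner_conj_symm]
  have ha : a = 1 := by
    rw [hρ'] at htr
    simpa [trace_rankOne, hΨ1] using htr
  refine ⟨Ψ, hΨW, hΨ1, ?_⟩
  rw [hρ', ha, one_smul]

/-- An eigenbasis of `S` will do; in it, equality holds. -/
theorem exists_traceNorm_le [CompleteSpace V] {S : V →L[ℂ] V} (hS : IsSelfAdjoint S) :
    ∃ u : OrthonormalBasis (Fin (Module.finrank ℂ V)) ℂ V,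
      traceNorm S ≤ ∑ i, ‖inner ℂ (u i) (S (u i))‖ := by
  have hsym : S.toLinearMap.IsSymmetric := hS.isSymmetric
  let u := hsym.eigenvectorBasis rfl
  refine ⟨u, ?_⟩
  rw [traceNorm, LinearMap.trace_eq_sum_inner _ u, Complex.re_sum]
  refine Finset.sum_le_sum fun i _ => ?_
  have hu : S (u i) = (hsym.eigenvalues rfl i : ℂ) • u i := hsym.apply_eigenvectorBasis rfl i
  calc (inner ℂ (u i) (CFC.abs S (u i))).re ≤ ‖inner ℂ (u i) (CFC.abs S (u i))‖ :=
        Complex.re_le_norm _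
    _ ≤ ‖u i‖ * ‖CFC.abs S (u i)‖ := norm_inner_le_norm _ _
    _ = ‖inner ℂ (u i) (S (u i))‖ := by
        rw [norm_abs_apply, hu, inner_smul_right, inner_self_eq_norm_sq_to_K, norm_smul, norm_mul]
        simp

/-- Bounds on the diagonal entries of each difference, uniform over the orthonormal bases, replace
the triangle inequality of the trace norm. -/
theorem traceNorm_sum_sub_le [CompleteSpace V] {J : Type*} [Fintype J] {w : J → ℝ}
    (hw : ∀ j, 0 ≤ w j) (x y : J → V) (B : J → ℝ)
    (hB : ∀ j (u : OrthonormalBasis (Fin (Module.finrank ℂ V)) ℂ V),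
      ∑ i, |‖inner ℂ (u i) (x j)‖ ^ 2 - ‖inner ℂ (u i) (y j)‖ ^ 2| ≤ B j) :
    traceNorm (∑ j, (w j : ℂ) • (rankOne ℂ (x j) (x j) - rankOne ℂ (y j) (y j)))
      ≤ ∑ j, w j * B j := by
  have hrank : ∀ v : V, IsSelfAdjoint (rankOne ℂ v v) := fun v =>
    (isPositive_rankOne_self v).isSelfAdjoint
  obtain ⟨u, hu⟩ := exists_traceNorm_le
    (S := ∑ j, (w j : ℂ) • (rankOne ℂ (x j) (x j) - rankOne ℂ (y j) (y j)))
    (isSelfAdjoint_sum _ fun j _ =>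
      IsSelfAdjoint.smul (Complex.conj_ofReal _) ((hrank _).sub (hrank _)))
  refine hu.trans ?_
  have h1 : ∀ i v, inner ℂ (u i) (rankOne ℂ v v (u i)) = ((‖inner ℂ (u i) v‖ ^ 2 : ℝ) : ℂ) := by
    intro i v
    rw [rankOne_apply, inner_smul_right, ← inner_conj_symm v, mul_comm, Complex.mul_conj,
      Complex.normSq_eq_norm_sq]
  have h2 : ∀ i, ‖inner ℂ (u i)
      ((∑ j, (w j : ℂ) • (rankOne ℂ (x j) (x j) - rankOne ℂ (y j) (y j))) (u i))‖
      ≤ ∑ j, w j * |‖inner ℂ (u i) (x j)‖ ^ 2 - ‖inner ℂ (u i) (y j)‖ ^ 2| := by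
    intro i
    rw [sum_apply, inner_sum]
    refine (norm_sum_le _ _).trans (Finset.sum_le_sum fun j _ => ?_)
    rw [smul_apply, inner_smul_right, sub_apply, inner_sub_right, h1, h1, ← Complex.ofReal_sub,
      norm_mul, Complex.norm_real, Complex.norm_real, Real.norm_eq_abs, abs_of_nonneg (hw j),
      Real.norm_eq_abs]
  refine (Finset.sum_le_sum fun i _ => h2 i).trans ?_
  rw [Finset.sum_comm]
  refine Finset.sum_le_sum fun j _ => ?_
  rw [← Finset.mul_sum]
  exact mul_le_mul_of_nonneg_left (hB j u) (hw j)

end Operators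

/-! ### The exponential de Finetti bound -/

section DeFinetti

open InnerProductSpace TensorPow MeasureTheory

variable {H : Type*} [NormedAddCommGroup H] [InnerProductSpace ℂ H] [FiniteDimensional ℂ H]

theorem TensorPow.one_le_finrank {m : ℕ} (hm : 1 ≤ m) {Ψ : TensorPow H m} (hΨ : Ψ ≠ 0) :
    1 ≤ Module.finrank ℂ H := by
  by_contra h
  have h0 : Module.finrank ℂ H = 0 := by omega
  have : IsEmpty (Fin m → Fin (Module.finrank ℂ H)) :=
    ⟨fun a => absurd (a ⟨0, hm⟩).2 (by omega)⟩
  refine hΨ (norm_eq_zero.1 (pow_eq_zero_iff two_ne_zero |>.1 ?_))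
  rw [← (prodBasis (stdOrthonormalBasis ℂ H) m).sum_sq_norm_inner_right]
  simp

/-- For each `θ`, the state conditioned on finding `θ` in the last `k` subsystems is exponentially
close to a pure state on the symmetric subspace along `θ^{⊗(n-r)}`. -/
theorem exists_pure_approximation {n k r : ℕ} {Ψ : TensorPow H (n + k)}
    (hΨ : Ψ ∈ symSubspace H (n + k)) (hΨ1 : ‖Ψ‖ = 1) {θ : H} (hθ : ‖θ‖ = 1) :
    ∃ χ ∈ symSubspaceAlong (Nat.sub_le n r) θ, ‖χ‖ = 1 ∧
      ∀ u : OrthonormalBasis (Fin (Module.finrank ℂ (TensorPow H n))) ℂ (TensorPow H n),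
        ∑ i, |‖inner ℂ (u i) (contract n (prodVec fun _ : Fin k => θ) Ψ)‖ ^ 2
            - ‖inner ℂ (u i)
              ((‖contract n (prodVec fun _ : Fin k => θ) Ψ‖ : ℂ) • χ)‖ ^ 2|
          ≤ 2 * ‖contract n (prodVec fun _ : Fin k => θ) Ψ‖
            * Real.exp (-((k : ℝ) * ((r : ℝ) + 1)) / (2 * ((n : ℝ) + (k : ℝ)))) := by
  obtain ⟨Φ, hΦ, horth, hbound⟩ := exists_truncation (r := r) hΨ hθ
  obtain ⟨χ, hχ, hχ1, h⟩ := exists_unit_approximation hΦ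
    (prodVec_const_mem_symSubspaceAlong (Nat.sub_le n r) θ) (norm_prodVec_const hθ n) horth
  refine ⟨χ, hχ, hχ1, fun u => (h u).trans (mul_le_mul_of_nonneg_left ?_ (by positivity))⟩
  refine abs_le_of_sq_le_sq' ?_ (Real.exp_pos _).le |>.2
  rw [hΨ1, one_pow, mul_one] at hbound
  refine hbound.trans (le_of_eq ?_)
  rw [← Real.exp_nat_mul]
  congr 1
  push_cast
  rw [← mul_div_assoc, mul_div_mul_left _ _ (two_ne_zero)]

theorem sum_weight_mul_le {J : Type*} [Fintype J] {w a : J → ℝ} (hw : ∀ j, 0 ≤ w j)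
    (h1 : ∑ j, w j * a j ^ 2 = 1) {d k : ℕ} (hk : 1 ≤ k)
    (hW : ∑ j, w j ≤ (k : ℝ) ^ d) :
    ∑ j, w j * a j ≤ Real.exp (1 / 2 * (d : ℝ) * Real.log k) := by
  refine abs_le_of_sq_le_sq' ?_ (Real.exp_pos _).le |>.2
  have h := Finset.sum_sq_le_sum_mul_sum_of_sq_le_mul Finset.univ (r := fun j => w j * a j)
    (f := w) (g := fun j => w j * a j ^ 2) (fun j _ => hw j)
    (fun j _ => mul_nonneg (hw j) (sq_nonneg _)) (fun j _ => le_of_eq (by ring))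
  rw [h1, mul_one] at h
  refine h.trans (hW.trans (le_of_eq ?_))
  rw [← Real.exp_nat_mul]
  have : ((2 : ℕ) : ℝ) * (1 / 2 * (d : ℝ) * Real.log k) = d * Real.log k := by push_cast; ring
  rw [this, Real.exp_nat_mul, Real.exp_log (by exact_mod_cast hk)]

end DeFinetti

theorem mainTheorem3 {H : Type*} [NormedAddCommGroup H] [InnerProductSpace ℂ H]
    [FiniteDimensional ℂ H] [MeasurableSpace H] [BorelSpace H]
    (n k r : ℕ) (hk : 1 ≤ k) (hr : r ≤ n)
    (ρ : TensorPow H (n + k) →L[ℂ] TensorPow H (n + k))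
    (hρ : IsPureDensityOperatorOn (TensorPow.symSubspace H (n + k)) ρ) :
    ∃ (ν : MeasureTheory.Measure (Metric.sphere (0 : H) 1))
      (ρbar : Metric.sphere (0 : H) 1 → (TensorPow H n →L[ℂ] TensorPow H n)),
      ν Set.univ ≤ 1 ∧
      (2 ≤ k → MeasureTheory.IsProbabilityMeasure ν) ∧
      (∀ θ : Metric.sphere (0 : H) 1, IsPureDensityOperatorOn
        (TensorPow.symSubspaceAlong (Nat.sub_le n r) (θ : H)) (ρbar θ)) ∧
      MeasureTheory.Integrable ρbar ν ∧
      traceNorm (TensorPow.partialTrace n k ρ - ∫ θ, ρbar θ ∂ν) ≤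
        2 * Real.exp (-((k : ℝ) * ((r : ℝ) + 1)) / (2 * ((n : ℝ) + (k : ℝ))) +
          1 / 2 * (Module.finrank ℂ H : ℝ) * Real.log (k : ℝ)) := by
  obtain ⟨Ψ, hΨ, hΨ1, rfl⟩ := hρ.exists_eq_rankOne
  have hd : 1 ≤ Module.finrank ℂ H :=
    TensorPow.one_le_finrank (Ψ := Ψ) (by omega)
      (norm_ne_zero_iff.1 (by rw [hΨ1]; exact one_ne_zero))
  obtain ⟨R⟩ := TensorPow.nonempty_symResolution hk hd
  have hnorm := R.sum_norm_sq_contract hΨ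
  rw [hΨ1, one_pow] at hnorm
  choose χ hχ hχ1 hχu using fun θ : Metric.sphere (0 : H) 1 =>
    exists_pure_approximation (r := r) hΨ hΨ1 (norm_eq_of_mem_sphere θ)
  let θ (j : R.J) : Metric.sphere (0 : H) 1 := ⟨R.θ j, by simpa using R.norm_θ j⟩
  let x (j : R.J) : TensorPow H n :=
    TensorPow.contract n (TensorPow.prodVec fun _ : Fin k => R.θ j) Ψ
  let ρbar (θ : Metric.sphere (0 : H) 1) := InnerProductSpace.rankOne ℂ (χ θ) (χ θ)
  have hpure : ∀ θ : Metric.sphere (0 : H) 1, IsPureDensityOperatorOn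
      (TensorPow.symSubspaceAlong (Nat.sub_le n r) (θ : H)) (ρbar θ) := fun θ =>
    isPureDensityOperatorOn_rankOne (hχ θ) (hχ1 θ)
  rcases hk.eq_or_lt with rfl | hk2
  · -- For `k = 1` the bound is at least `2 exp (-1/2) ≥ 1`, the trace norm of the reduced state.
    refine ⟨0, ρbar, by simp, fun h => absurd h (by norm_num), hpure,
      MeasureTheory.integrable_zero_measure, ?_⟩
    have h1 : traceNorm (TensorPow.partialTrace n 1 (InnerProductSpace.rankOne ℂ Ψ Ψ)) ≤ 1 := by
      have h := traceNorm_sum_sub_le R.w_nonneg x (fun _ => 0) (fun j => ‖x j‖ ^ 2)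
        (fun j u => by simp [u.sum_sq_norm_inner_right])
      rw [R.partialTrace_rankOne_self hΨ]
      simpa [hnorm, x] using h
    rw [MeasureTheory.integral_zero_measure, sub_zero]
    refine h1.trans ?_
    have hrn : (r : ℝ) ≤ n := by exact_mod_cast hr
    have h2 : -(1 / 2 : ℝ)
        ≤ -(((1 : ℕ) : ℝ) * ((r : ℝ) + 1)) / (2 * ((n : ℝ) + ((1 : ℕ) : ℝ))) := by
      rw [le_div_iff₀ (by positivity)]
      push_cast
      linarith
    have h3 := Real.add_one_le_exp
      (-(((1 : ℕ) : ℝ) * ((r : ℝ) + 1)) / (2 * ((n : ℝ) + ((1 : ℕ) : ℝ))))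
    simp only [Nat.cast_one, Real.log_one, mul_zero, add_zero] at h2 h3 ⊢
    linarith
  · -- The mass at `θ j` is that of `x j`, although the truncation of `x j` may be shorter: this
    -- makes the total mass one.
    let ν : MeasureTheory.Measure (Metric.sphere (0 : H) 1) :=
      ∑ j, ENNReal.ofReal (R.w j * ‖x j‖ ^ 2) • MeasureTheory.Measure.dirac (θ j)
    have hmass : ∀ j, 0 ≤ R.w j * ‖x j‖ ^ 2 := fun j => mul_nonneg (R.w_nonneg j) (sq_nonneg _)
    have hν : ν Set.univ = 1 := by
      simp only [ν, MeasureTheory.Measure.finsetSum_apply, MeasureTheory.Measure.smul_apply,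
        MeasureTheory.measure_univ, smul_eq_mul, mul_one]
      rw [← ENNReal.ofReal_sum_of_nonneg fun j _ => hmass j, hnorm, ENNReal.ofReal_one]
    have hint : ∀ j, MeasureTheory.Integrable ρbar
        (ENNReal.ofReal (R.w j * ‖x j‖ ^ 2) • MeasureTheory.Measure.dirac (θ j)) := fun j =>
      (MeasureTheory.integrable_dirac (by simp)).smul_measure ENNReal.ofReal_ne_top
    refine ⟨ν, ρbar, hν.le, fun _ => ⟨hν⟩, hpure,
      MeasureTheory.integrable_finsetSum_measure.2 fun j _ => hint j, ?_⟩
    have hintegral : ∫ θ, ρbar θ ∂ν = ∑ j, (R.w j : ℂ) • InnerProductSpace.rankOne ℂ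
        ((‖x j‖ : ℂ) • χ (θ j)) ((‖x j‖ : ℂ) • χ (θ j)) := by
      rw [MeasureTheory.integral_finsetSum_measure fun j _ => hint j]
      refine Finset.sum_congr rfl fun j _ => ?_
      rw [MeasureTheory.integral_smul_measure, MeasureTheory.integral_dirac,
        ENNReal.toReal_ofReal (hmass j)]
      ext v
      simp only [ρbar, smul_apply, InnerProductSpace.rankOne_apply, inner_smul_left, smul_smul,
        Complex.conj_ofReal, ← Complex.coe_smul (R.w j * ‖x j‖ ^ 2)]
      congr 1
      push_cast
      ring
    have hbound := traceNorm_sum_sub_le R.w_nonneg x (fun j => (‖x j‖ : ℂ) • χ (θ j)) _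
      (fun j u => hχu (θ j) u)
    rw [hintegral, R.partialTrace_rankOne_self hΨ, ← Finset.sum_sub_distrib]
    simp only [← smul_sub]
    refine hbound.trans ?_
    have hW : ∑ j, R.w j ≤ (k : ℝ) ^ Module.finrank ℂ H := by
      refine R.sum_w_le.trans ?_
      exact_mod_cast Nat.multichoose_le_pow hd hk2
    have hsum := sum_weight_mul_le R.w_nonneg hnorm hk hW
    rw [Real.exp_add]
    set ε := Real.exp (-((k : ℝ) * ((r : ℝ) + 1)) / (2 * ((n : ℝ) + (k : ℝ))))
    have hε : 0 ≤ 2 * ε := by positivity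
    calc ∑ j, R.w j * (2 * ‖x j‖ * ε) = 2 * ε * ∑ j, R.w j * ‖x j‖ := by
          rw [Finset.mul_sum]
          exact Finset.sum_congr rfl fun j _ => by ring
      _ ≤ 2 * ε * Real.exp (1 / 2 * (Module.finrank ℂ H : ℝ) * Real.log k) :=
          mul_le_mul_of_nonneg_left hsum hε
      _ = _ := by ring
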